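/- Let $\mathcal X$ be an infinite-dimensional separable real Hilbert space. Let $\mathcal C_0$ be a bounded, self-adjoint, positive-definite operator on $\mathcal X$ with orthonormal eigenbasis $(\phi_k)$, $\mathcal C_0\phi_k=\kappa_k\phi_k$, let $\mathcal C_1$ be a bounded, self-adjoint, positive-definite operator (not necessarily trace class), and let $\mathcal A$ be a self-adjoint, positive-definite, possibly unbounded operator with bounded inverse $\mathcal A^{-1}:\mathcal X\to\mathcal X$. For $t\in\mathbb R$ let $X^t$ be the Hilbert scale of $\mathcal C_0$, with norm $\|u\|_t=\|\mathcal C_0^{-t/2}u\|=\big(\sum_k\kappa_k^{-t}\langle\phi_k,u\rangle^2\big)^{1/2}$. Assume that there are $s_0\in[0,1)$, $\beta,\ell\ge 0$ and constants $c_1,\dots,c_4>0$ such that, with $\Delta=2\ell-\beta+1$, 1. $\mathcal C_0^s$ is trace class for all $s>s_0$; 2. $\Delta>2s_0$; 3. $\|\mathcal C_1^{-1/2}\mathcal A^{-1}u\|\asymp\|\mathcal C_0^{\ell-\beta/2}u\|$ for all $u\in X^{\beta-2\ell}$; 4. $\|\mathcal C_0^{-\rho/2}\mathcal C_1^{1/2}u\|\le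 c_1\|\mathcal C_0^{(\beta-\rho)/2}u\|$ for all $u\in X^{\rho-\beta}$ and $\rho\in[\lceil\beta-s_0-1\rceil,\beta-s_0)$; 5. $\|\mathcal C_0^{s/2}\mathcal C_1^{-1/2}u\|\le c_2\|\mathcal C_0^{(s-\beta)/2}u\|$ for all $u\in X^{\beta-s}$ and $s\in(s_0,1]$; 6. $\|\mathcal C_0^{-s/2}\mathcal C_1^{-1/2}\mathcal A^{-1}u\|\le c_3\|\mathcal C_0^{(2\ell-\beta-s)/2}u\|$ for all $u\in X^{s+\beta-2\ell}$ and $s\in(s_0,1]$; 7. $\|\mathcal C_0^{\eta/2}\mathcal A^{-1}\mathcal C_1^{-1}u\|\le c_4\|\mathcal C_0^{\eta/2+\ell-\beta}u\|$ for all $u\in X^{2\beta-2\ell-\eta}$ and $\eta\in[\beta-2\ell,1]$. (It suffices that these inequalities hold for those $u$ in the stated space which lie in $\mathcal X$ and, in 5 and 7, in the domain of $\mathcal C_1^{-1/2}$ and $\mathcal C_1^{-1}$ respectively; in 3, $\mathcal A^{-1}u$ is required to lie in the domain of $\mathcal C_1^{-1/2}$.) For $n\in\mathbb N$ and $\tau>0$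 consider the Bayesian model in which $u\sim\mathcal N(0,\tau^2\mathcal C_0)$ and, given $u$, the data are $y=\mathcal A^{-1}u+n^{-1/2}\xi$ with $\xi\sim\mathcal N(0,\mathcal C_1)$ independent of $u$ (the noise, hence $y$, is a generalized random element given by its coordinates in the basis $(\phi_k)$). Let $\mu^{y}_{n,\tau}$ be the posterior, that is, the conditional law of $u$ given $y$. Let $u^\dagger\in X^\gamma$ with $\gamma\ge1$, and let $\varepsilon>0$. Then, for the choices of $\tau=\tau(n)$ and $\varepsilon_n$ below, $$\mathbb E^{y^\dagger}\,\mu^{y^\dagger}_{n,\tau(n)}\{u:\|u-u^\dagger\|\ge M_n\varepsilon_n\}\to0\quad(n\to\infty)\qquad\text{for every sequence }M_n\to\infty,$$ where $y^\dagger=\mathcal A^{-1}u^\dagger+n^{-1/2}\xi\sim\mathcal N(\mathcal A^{-1}u^\dagger,\tfrac1n\mathcal C_1)$: (i) if $\gamma\in[1,\Delta+1]$, for $\tau(n)=n^{-\frac{\gamma-1+s_0+\varepsilon}{2(\Delta+\gamma-1+s_0+\varepsilon)}}$ and $$\varepsilon_n=\begin{cases}n^{-\frac{\gamma}{2(\Delta+\gamma-1+s_0+\varepsilon)}}&\text{if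 }\beta-2\ell\le0,\\ n^{-\frac{\Delta+\gamma-1}{2(\Delta+\gamma-1+s_0+\varepsilon)}}&\text{otherwise;}\end{cases}$$ (ii) if $\gamma>\Delta+1$, for $\tau(n)=n^{-\frac{\Delta+s_0+\varepsilon}{2(2\Delta+s_0+\varepsilon)}}$ and $$\varepsilon_n=\begin{cases}n^{-\frac{\Delta+1}{2(2\Delta+s_0+\varepsilon)}}&\text{if }\beta-2\ell\le0,\\ n^{-\frac{\Delta}{2\Delta+s_0+\varepsilon}}&\text{otherwise.}\end{cases}$$ In particular, if $\beta\le2\ell$, then $\varepsilon_n=n^{-\frac{\gamma\wedge(\Delta+1)}{2(\Delta+\gamma\wedge(\Delta+1)-1+s_0+\varepsilon)}}$ in both cases. -/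

import Mathlib

open MeasureTheory ProbabilityTheory Filter Topology
open scoped RealInnerProductSpace

namespace LinInv

noncomputable section

variable {X : Type*} [NormedAddCommGroup X] [InnerProductSpace ℝ X]

/-! ### Operators -/

/-- A bounded, self-adjoint, positive-definite operator on the real Hilbert space `X`. -/
structure IsPosDef [CompleteSpace X] (T : X →L[ℝ] X) : Prop where
  isSelfAdjoint : IsSelfAdjoint T
  pos : ∀ u : X, u ≠ 0 → 0 < ⟪T u, u⟫

/-- `R` is the positive square root of `T` (which determines `R` uniquely). -/
structure IsPosSqrt [CompleteSpace X] (R T : X →L[ℝ] X) : Prop where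
  isPositive : R.IsPositive
  comp_self : R ∘L R = T

/-- `A` is a (possibly unbounded) self-adjoint, positive-definite operator and the bounded
operator `K` is its inverse. -/
structure IsPosDefWithInverse [CompleteSpace X] (A : X →ₗ.[ℝ] X) (K : X →L[ℝ] X) : Prop where
  isSelfAdjoint : IsSelfAdjoint A
  pos : ∀ u : A.domain, (u : X) ≠ 0 → 0 < ⟪A u, (u : X)⟫
  right_inv : ∀ x : X, ∃ h : K x ∈ A.domain, A ⟨K x, h⟩ = x
  left_inv : ∀ u : A.domain, K (A u) = u

/-! ### The Hilbert scale of the prior covariance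

`φ` is an orthonormal eigenbasis of `C₀` with eigenvalues `κ k > 0`, so that
`‖C₀^{-t/2} u‖² = ∑ₖ κₖ^{-t} ⟨φₖ, u⟩²`. -/

/-- `u ∈ X^t`, for an element `u` of `X`. For `t ≥ 0` this is the whole of the space `X^t`. For
`t < 0` it holds for all `u : X`, and `X` is a dense subspace of `X^t`. -/
def MemScale (φ : HilbertBasis ℕ ℝ X) (κ : ℕ → ℝ) (t : ℝ) (u : X) : Prop :=
  Summable fun k => κ k ^ (-t) * ⟪φ k, u⟫ ^ 2

/-- The norm `‖u‖_t = ‖C₀^{-t/2} u‖` of the space `X^t`. -/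
def scaleNorm (φ : HilbertBasis ℕ ℝ X) (κ : ℕ → ℝ) (t : ℝ) (u : X) : ℝ :=
  √(∑' k, κ k ^ (-t) * ⟪φ k, u⟫ ^ 2)

/-- The standing assumptions relating the prior covariance `C₀` (through its eigenpairs
`κ k, φ k`), the noise covariance `C₁` with square root `R = C₁^{1/2}`, and the forward operator
`K = A⁻¹`.

The inequalities are required for arguments `u` in `X` (and in the domain of `C₁^{-1/2}` or `C₁⁻¹`
where that operator is applied first; the value is then written as the preimage `w` of `u` under
`R` or `C₁`). For arguments in a space of negative order they are understood by continuous
extension. -/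
structure ScaleAssumptions (φ : HilbertBasis ℕ ℝ X) (κ : ℕ → ℝ) (C₁ R K : X →L[ℝ] X)
    (s₀ β ℓ : ℝ) : Prop where
  s₀_nonneg : 0 ≤ s₀
  s₀_lt_one : s₀ < 1
  β_nonneg : 0 ≤ β
  ℓ_nonneg : 0 ≤ ℓ
  /-- `C₀^s` is trace class for all `s > s₀`. -/
  traceClass : ∀ s : ℝ, s₀ < s → Summable fun k => κ k ^ s
  /-- `Δ > 2 s₀`, where `Δ = 2ℓ - β + 1`. -/
  illPosed : 2 * s₀ < 2 * ℓ - β + 1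
  /-- `‖C₁^{-1/2} A⁻¹ u‖ ≍ ‖C₀^{ℓ-β/2} u‖` on `X^{β-2ℓ}`; in particular `A⁻¹ u` lies in the domain
  of `C₁^{-1/2}`. -/
  equiv_forward : ∃ c > 0, ∃ c' > 0, ∀ u : X, MemScale φ κ (β - 2 * ℓ) u →
    ∃ w : X, R w = K u ∧ c * ‖w‖ ≤ scaleNorm φ κ (β - 2 * ℓ) u ∧
      scaleNorm φ κ (β - 2 * ℓ) u ≤ c' * ‖w‖
  /-- `‖C₀^{-ρ/2} C₁^{1/2} u‖ ≤ c₁ ‖C₀^{(β-ρ)/2} u‖` on `X^{ρ-β}`. -/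
  sqrt_bound : ∃ c₁ > 0, ∀ ρ : ℝ, (⌈β - s₀ - 1⌉ : ℝ) ≤ ρ → ρ < β - s₀ →
    ∀ u : X, MemScale φ κ (ρ - β) u →
      MemScale φ κ ρ (R u) ∧ scaleNorm φ κ ρ (R u) ≤ c₁ * scaleNorm φ κ (ρ - β) u
  /-- `‖C₀^{s/2} C₁^{-1/2} u‖ ≤ c₂ ‖C₀^{(s-β)/2} u‖` on `X^{β-s}`, with `u = C₁^{1/2} w`. -/
  invSqrt_bound : ∃ c₂ > 0, ∀ s : ℝ, s₀ < s → s ≤ 1 →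
    ∀ w : X, MemScale φ κ (β - s) (R w) →
      MemScale φ κ (-s) w ∧ scaleNorm φ κ (-s) w ≤ c₂ * scaleNorm φ κ (β - s) (R w)
  /-- `‖C₀^{-s/2} C₁^{-1/2} A⁻¹ u‖ ≤ c₃ ‖C₀^{(2ℓ-β-s)/2} u‖` on `X^{s+β-2ℓ}`, with
  `w = C₁^{-1/2} A⁻¹ u`. -/
  forward_bound : ∃ c₃ > 0, ∀ s : ℝ, s₀ < s → s ≤ 1 →
    ∀ u w : X, MemScale φ κ (s + β - 2 * ℓ) u → R w = K u →
      MemScale φ κ s w ∧ scaleNorm φ κ s w ≤ c₃ * scaleNorm φ κ (s + β - 2 * ℓ) u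
  /-- `‖C₀^{η/2} A⁻¹ C₁⁻¹ u‖ ≤ c₄ ‖C₀^{η/2+ℓ-β} u‖` on `X^{2β-2ℓ-η}`, with `u = C₁ w`. -/
  precision_bound : ∃ c₄ > 0, ∀ η : ℝ, β - 2 * ℓ ≤ η → η ≤ 1 →
    ∀ w : X, MemScale φ κ (2 * β - 2 * ℓ - η) (C₁ w) →
      MemScale φ κ (-η) (K w) ∧
        scaleNorm φ κ (-η) (K w) ≤ c₄ * scaleNorm φ κ (2 * β - 2 * ℓ - η) (C₁ w)

/-! ### Gaussian laws -/

variable [MeasurableSpace X] [BorelSpace X]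

/-- `μ = N(0, C)` on the Hilbert space `X`. -/
structure IsCenteredGaussian [CompleteSpace X] (μ : Measure X) (C : X →L[ℝ] X) : Prop where
  isGaussian : IsGaussian μ
  mean : ∫ u, u ∂μ = 0
  cov : ∀ u v : X, covarianceBilin μ u v = ⟪C u, v⟫

/-- `P` is the law `N(0, C)`, where `C` is bounded but not necessarily trace class (`C = 1` is
white noise). A draw `ξ` need not belong to `X`, and is given by the sequence of its coordinates
`ξ k = ⟨φ k, ξ⟩` in the orthonormal basis `φ`: these are jointly Gaussian and centered, with
covariances `⟨C φ j, φ k⟩`. -/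
structure IsCenteredGaussianSeq (P : Measure (ℕ → ℝ)) (φ : HilbertBasis ℕ ℝ X)
    (C : X →L[ℝ] X) : Prop where
  isGaussian : IsGaussianProcess (fun (k : ℕ) (x : ℕ → ℝ) => x k) P
  mean : ∀ k, ∫ x, x k ∂P = 0
  cov : ∀ j k, cov[fun x => x j, fun x => x k; P] = ⟪C (φ j), φ k⟫

/-! ### The Bayesian inverse problem -/

/-- The coordinates of the data `y = K u + n^{-1/2} ξ`. -/
def dataOf (φ : HilbertBasis ℕ ℝ X) (K : X →L[ℝ] X) (n : ℕ) (p : X × (ℕ → ℝ)) : ℕ → ℝ :=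
  fun k => ⟪φ k, K p.1⟫ + (√(n : ℝ))⁻¹ * p.2 k

theorem measurable_dataOf (φ : HilbertBasis ℕ ℝ X) (K : X →L[ℝ] X) (n : ℕ) :
    Measurable (dataOf φ K n) := by
  refine measurable_pi_lambda _ fun k => ?_
  have h1 : Measurable fun u : X => ⟪φ k, K u⟫ :=
    (Continuous.inner continuous_const K.continuous).measurable
  have h2 : Measurable fun x : ℕ → ℝ => x k := measurable_pi_apply k
  exact (h1.comp measurable_fst).add ((h2.comp measurable_snd).const_mul _)

/-- The likelihood: the law `N(K u, n⁻¹ C₁)` of the data given `u`, where `P` is the law `N(0, C₁)`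
of the noise. -/
def likelihood (φ : HilbertBasis ℕ ℝ X) (K : X →L[ℝ] X) (P : Measure (ℕ → ℝ)) (n : ℕ) :
    Kernel X (ℕ → ℝ) :=
  (Kernel.id ×ₖ Kernel.const X P).map (dataOf φ K n)

instance (φ : HilbertBasis ℕ ℝ X) (K : X →L[ℝ] X) (P : Measure (ℕ → ℝ)) [IsProbabilityMeasure P]
    (n : ℕ) : IsMarkovKernel (likelihood φ K P n) :=
  Kernel.IsMarkovKernel.map _ (measurable_dataOf φ K n)

theorem likelihood_apply (φ : HilbertBasis ℕ ℝ X) (K : X →L[ℝ] X) (P : Measure (ℕ → ℝ))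
    [IsProbabilityMeasure P] (n : ℕ) (u : X) :
    likelihood φ K P n u = P.map fun x => dataOf φ K n (u, x) := by
  rw [likelihood, Kernel.map_apply _ (measurable_dataOf φ K n), Kernel.prod_apply,
    Kernel.id_apply, Kernel.const_apply, Measure.dirac_prod,
    Measure.map_map (measurable_dataOf φ K n) (by fun_prop)]
  rfl

/-- The prior `N(0, τ² C₀)`, where `μ` is the law `N(0, C₀)`. -/
def prior (μ : Measure X) (τ : ℝ) : Measure X := μ.map fun u => τ • u

instance (μ : Measure X) [IsProbabilityMeasure μ] (τ : ℝ) : IsFiniteMeasure (prior μ τ) := by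
  unfold prior; infer_instance

/-- The posterior: the conditional law of `u` given the data `y = K u + n^{-1/2} ξ`, for the prior
`N(0, τ² C₀)` and independent noise `ξ ∼ N(0, C₁)`. -/
def posteriorLaw [CompleteSpace X] [SecondCountableTopology X] (φ : HilbertBasis ℕ ℝ X)
    (K : X →L[ℝ] X) (μ : Measure X) [IsProbabilityMeasure μ] (P : Measure (ℕ → ℝ))
    [IsProbabilityMeasure P] (n : ℕ) (τ : ℝ) : Kernel (ℕ → ℝ) X :=
  posterior (likelihood φ K P n) (prior μ τ)

/-- Contraction of the posterior to the point mass at `u'` at rate `r`, for the prior scaling `τ`: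
for every `Mₙ → ∞`, the expectation of the posterior mass of `{u : ‖u - u'‖ ≥ Mₙ rₙ}`, under
data with law `N(K u', n⁻¹ C₁)`, tends to `0`. -/
def PosteriorContracts [CompleteSpace X] [SecondCountableTopology X] (φ : HilbertBasis ℕ ℝ X)
    (K : X →L[ℝ] X) (μ : Measure X) [IsProbabilityMeasure μ] (P : Measure (ℕ → ℝ))
    [IsProbabilityMeasure P] (u' : X) (τ r : ℕ → ℝ) : Prop :=
  ∀ M : ℕ → ℝ, Tendsto M atTop atTop →
    Tendsto (fun n : ℕ => ∫⁻ y, posteriorLaw φ K μ P n (τ n) y {u : X | M n * r n ≤ ‖u - u'‖}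
      ∂(likelihood φ K P n u')) atTop (𝓝 0)

end

end LinInv

namespace LinInv

/-! Write `D = C₀^{1/2}`, `M = C₁^{-1/2} K D` and `t = n τ²`. In the whitened variable `z`, with `u
= D z`, this is Gaussian regression with prior covariance `τ²` and white noise. The posterior
covariance is therefore `τ² D (1 + t M*M)⁻¹ D`, and the posterior mean at the truth `D z` has bias
`-D (1 + t M*M)⁻¹ z`. By Chebyshev it suffices to bound the mean square error. This is a sum over
coordinates, so only the conditional law of each `⟪φ k, u⟫` is needed
(`lintegral_posterior_coord_le`).

Two probabilistic points replace a density formula. The data are not in `X`, so `⟨h, C₁^{-1/2} y⟩`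
is built as an almost sure limit of finite combinations of coordinates. A coordinate of `u` minus
the right such functional is Gaussian and uncorrelated with the data, hence independent of them,
which identifies its conditional law (`indepFun_of_tendsto`, `posterior_map_ae_eq`). Also, a
posterior is determined only up to null sets of the marginal data law, so the data law at the truth
must be absolutely continuous with respect to that marginal (`likelihood_absolutelyContinuous`).
This follows from a Cameron–Martin shift.

The analysis is an energy estimate. `M` need not be diagonal in `φ`, but the norm equivalence gives
`‖M z‖² ≥ c ∑ κₖ^Δ ⟨φₖ, z⟩²`. Pairing the resolvent equation with its solution and using `κ^{Δθ} ≤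
t^{-θ} (1 + t κ^Δ)` bounds the variance by a multiple of `τ² t^{-ϑ} tr C₀^{1-Δϑ}`
(`posterior_variance_le`) and the squared bias by a multiple of `t^{-(σ+θ)}` (`bias_le`). Here `θ =
(γ-1)/Δ` encodes the smoothness and `σ = min(1, 1/Δ)` the norm of `X`. The given `τ` makes both
terms `O(εₙ²)`. The condition `θ ≤ 1` is the saturation `γ ≤ Δ + 1`; smoother truths are treated as
elements of `X^{Δ+1}`. -/

/-! ### Linear Gaussian families and their limits -/

/-- A family of real random variables `V g`, linear in `g`, with `V g ∼ N(0, ‖T g‖²)`. -/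
structure IsGaussianFamily {Ω E H : Type*} [MeasurableSpace Ω] [AddCommGroup E] [Module ℝ E]
    [NormedAddCommGroup H] [InnerProductSpace ℝ H] (V : E →ₗ[ℝ] (Ω → ℝ)) (T : E →ₗ[ℝ] H)
    (Q : Measure Ω) : Prop where
  measurable : ∀ g, Measurable (V g)
  map_eq : ∀ g, Q.map (V g) = gaussianReal 0 (‖T g‖₊ ^ 2)

theorem lintegral_add_const_sq_gaussianReal (v : NNReal) (b : ℝ) :
    ∫⁻ x, ENNReal.ofReal ((x + b) ^ 2) ∂(gaussianReal 0 v) = ENNReal.ofReal (v + b ^ 2) := by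
  have hmem : MemLp id 2 (gaussianReal 0 v) := memLp_id_gaussianReal 2
  have hid : Integrable (fun x : ℝ => x) (gaussianReal 0 v) := hmem.integrable (by norm_num)
  have hsq : Integrable (fun x : ℝ => x ^ 2) (gaussianReal 0 v) := hmem.integrable_sq
  have hvar : ∫ x, x ^ 2 ∂(gaussianReal 0 v) = v := by
    have := variance_id_gaussianReal (μ := 0) (v := v)
    rw [variance_eq_integral aemeasurable_id] at this
    simpa using this
  have hE : ∀ x : ℝ, (x + b) ^ 2 = x ^ 2 + 2 * b * x + b ^ 2 := fun x => by ring
  have hI : Integrable (fun x : ℝ => (x + b) ^ 2) (gaussianReal 0 v) := by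
    simp_rw [hE]
    exact (hsq.add (hid.const_mul _)).add (integrable_const _)
  rw [← ofReal_integral_eq_lintegral_ofReal hI (ae_of_all _ fun x => sq_nonneg _)]
  congr 1
  simp_rw [hE]
  have h1 : Integrable (fun x : ℝ => x ^ 2 + 2 * b * x) (gaussianReal 0 v) :=
    hsq.add (hid.const_mul _)
  rw [integral_add h1 (integrable_const _), integral_add hsq (hid.const_mul _),
    integral_const_mul, hvar, integral_id_gaussianReal]
  simp

namespace IsGaussianFamily

variable {Ω E H : Type*} [MeasurableSpace Ω] [AddCommGroup E] [Module ℝ E]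
    [NormedAddCommGroup H] [InnerProductSpace ℝ H] {V : E →ₗ[ℝ] (Ω → ℝ)} {T : E →ₗ[ℝ] H}
    {Q : Measure Ω}

theorem integral_cexp (hV : IsGaussianFamily V T Q) (g : E) :
    ∫ ω, Complex.exp (V g ω * Complex.I) ∂Q = (Real.exp (-(‖T g‖ ^ 2) / 2) : ℝ) := by
  have h := charFun_apply_real (μ := Q.map (V g)) 1
  rw [integral_map (hV.measurable g).aemeasurable (by fun_prop), hV.map_eq,
    charFun_gaussianReal] at h
  simp only [Complex.ofReal_one, one_mul] at h
  rw [← h]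
  push_cast
  congr 1
  simp
  ring

theorem tendsto_integral_cexp [IsFiniteMeasure Q] {f : ℕ → Ω → ℝ} {Z : Ω → ℝ}
    (hf : ∀ j, Measurable (f j)) (h : ∀ᵐ ω ∂Q, Tendsto (fun j => f j ω) atTop (𝓝 (Z ω))) :
    Tendsto (fun j => ∫ ω, Complex.exp (f j ω * Complex.I) ∂Q) atTop
      (𝓝 (∫ ω, Complex.exp (Z ω * Complex.I) ∂Q)) := by
  refine tendsto_integral_of_dominated_convergence (fun _ => 1)
    (fun j => ?_) (integrable_const _) (fun j => ae_of_all _ fun ω => ?_) ?_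
  · have := hf j
    exact Measurable.aestronglyMeasurable (by fun_prop)
  · rw [Complex.norm_exp_ofReal_mul_I]
  · filter_upwards [h] with ω hω
    have hc : Continuous fun r : ℝ => Complex.exp (r * Complex.I) := by fun_prop
    exact (hc.tendsto (Z ω)).comp hω

/-- An almost sure limit of elements of a Gaussian family is Gaussian. -/
theorem map_eq_of_tendsto [IsProbabilityMeasure Q] (hV : IsGaussianFamily V T Q) {g : ℕ → E} {h : H} {Z : Ω → ℝ}
    (hZ : Measurable Z) (hT : Tendsto (fun j => T (g j)) atTop (𝓝 h))
    (hg : ∀ᵐ ω ∂Q, Tendsto (fun j => V (g j) ω) atTop (𝓝 (Z ω))) :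
    Q.map Z = gaussianReal 0 (‖h‖₊ ^ 2) := by
  have := Measure.isProbabilityMeasure_map (μ := Q) hZ.aemeasurable
  refine Measure.ext_of_charFun (funext fun t => ?_)
  rw [charFun_apply_real, integral_map hZ.aemeasurable (by fun_prop), charFun_gaussianReal]
  -- Linearity of the family turns the characteristic function at `t` into that of `t • g j` at `1`.
  have h1 := tendsto_integral_cexp (fun j => hV.measurable (t • g j)) (Z := fun ω => t * Z ω)
    (by
      filter_upwards [hg] with ω hω
      simpa using hω.const_mul t)
  simp_rw [hV.integral_cexp] at h1
  have h2 : Tendsto (fun j => ((Real.exp (-(‖T (t • g j)‖ ^ 2) / 2) : ℝ) : ℂ)) atTop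
      (𝓝 ((Real.exp (-(‖t • h‖ ^ 2) / 2) : ℝ) : ℂ)) := by
    have hc : Continuous fun x : H => ((Real.exp (-(‖t • x‖ ^ 2) / 2) : ℝ) : ℂ) := by fun_prop
    simp_rw [map_smul]
    exact (hc.tendsto h).comp hT
  have h3 := tendsto_nhds_unique h1 h2
  push_cast at h3 ⊢
  rw [h3]
  congr 1
  rw [norm_smul]
  push_cast
  have : ((|t| : ℝ) : ℂ) ^ 2 = (t : ℂ) ^ 2 := by
    rw [← Complex.ofReal_pow, sq_abs, Complex.ofReal_pow]
  rw [Real.norm_eq_abs, mul_pow, this]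
  simp
  ring

/-- Asymptotically uncorrelated almost sure limits of elements of a Gaussian family are
independent. -/
theorem indepFun_of_tendsto [IsProbabilityMeasure Q] (hV : IsGaussianFamily V T Q) {ι : Type*}
    {g : ℕ → E} {v : ι → ℕ → E} {Z : Ω → ℝ} {Y : ι → Ω → ℝ} (hZ : Measurable Z) (hY : ∀ i, Measurable (Y i))
    (hg : ∀ᵐ ω ∂Q, Tendsto (fun j => V (g j) ω) atTop (𝓝 (Z ω)))
    (hv : ∀ i, ∀ᵐ ω ∂Q, Tendsto (fun j => V (v i j) ω) atTop (𝓝 (Y i ω)))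
    (hcov : ∀ i, Tendsto (fun j => ⟪T (g j), T (v i j)⟫) atTop (𝓝 0)) :
    IndepFun Z (fun ω i => Y i ω) Q := by
  classical
  refine IndepFun.indepFun_process hZ hY fun I => ?_
  have hYI : Measurable fun ω (i : I) => Y i ω := measurable_pi_lambda _ fun i => hY i
  rw [indepFun_iff_charFunDual_prod hZ.aemeasurable hYI.aemeasurable]
  intro L
  rw [charFunDual_apply, charFunDual_apply, charFunDual_apply,
    integral_map (hZ.prodMk hYI).aemeasurable (by fun_prop),
    integral_map hZ.aemeasurable (by fun_prop), integral_map hYI.aemeasurable (by fun_prop)]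
  set s : ℝ := L (1, 0) with hs
  set t : I → ℝ := fun i => L (0, Pi.single i 1) with ht
  have hL1 : ∀ z : ℝ, L (z, 0) = s * z := fun z => by
    have : ((z, 0) : ℝ × (I → ℝ)) = z • (1, 0) := by simp
    rw [this, map_smul, smul_eq_mul, mul_comm]
  have hL2 : ∀ y : I → ℝ, L (0, y) = ∑ i, t i * y i := fun y => by
    have : ((0, y) : ℝ × (I → ℝ)) = ∑ i, y i • (0, Pi.single i 1) := by
      refine Prod.ext ?_ ?_
      · simp [Prod.fst_sum]
      · simp only [Prod.snd_sum, Prod.smul_snd]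
        ext k
        simp [Finset.sum_apply, Pi.single_apply]
    rw [this, map_sum]
    refine Finset.sum_congr rfl fun i _ => ?_
    rw [map_smul, smul_eq_mul, mul_comm]
  have hL : ∀ (z : ℝ) (y : I → ℝ), L (z, y) = s * z + ∑ i, t i * y i := fun z y => by
    rw [← hL1, ← hL2, ← map_add]
    simp
  set w : ℕ → E := fun j => ∑ i : I, t i • v i j with hw
  have hVw : ∀ j ω, V (w j) ω = ∑ i : I, t i * V (v i j) ω := fun j ω => by
    simp [hw, map_sum, Finset.sum_apply]
  have hVw' : ∀ᵐ ω ∂Q, Tendsto (fun j => V (w j) ω) atTop (𝓝 (∑ i : I, t i * Y i ω)) := by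
    have : ∀ᵐ ω ∂Q, ∀ i : I, Tendsto (fun j => V (v i j) ω) atTop (𝓝 (Y i ω)) :=
      ae_all_iff.2 fun i => hv i
    filter_upwards [this] with ω hω
    simp_rw [hVw]
    exact tendsto_finsetSum _ fun i _ => (hω i).const_mul _
  have hVg' : ∀ᵐ ω ∂Q, Tendsto (fun j => V (s • g j) ω) atTop (𝓝 (s * Z ω)) := by
    filter_upwards [hg] with ω hω
    simpa using hω.const_mul s
  have hsum : ∀ᵐ ω ∂Q, Tendsto (fun j => V (s • g j + w j) ω) atTop
      (𝓝 (s * Z ω + ∑ i : I, t i * Y i ω)) := by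
    filter_upwards [hVw', hVg'] with ω h1 h2
    simpa using h2.add h1
  have l1 := tendsto_integral_cexp (fun j => hV.measurable _) hsum
  have l2 := tendsto_integral_cexp (fun j => hV.measurable _) hVg'
  have l3 := tendsto_integral_cexp (fun j => hV.measurable _) hVw'
  simp_rw [hV.integral_cexp] at l1 l2 l3
  -- The joint characteristic function differs from the product of the marginal ones only by the
  -- factor `exp(-⟪·, ·⟫)` of this cross term, which tends to `1`.
  have hc : Tendsto (fun j => ⟪T (s • g j), T (w j)⟫) atTop (𝓝 0) := by
    have : ∀ j, ⟪T (s • g j), T (w j)⟫ = s * ∑ i : I, t i * ⟪T (g j), T (v i j)⟫ := fun j => by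
      simp only [hw, map_sum, map_smul, inner_sum, inner_smul_left, inner_smul_right,
        Finset.mul_sum]
      exact Finset.sum_congr rfl fun i _ => by simp; ring
    simp_rw [this]
    simpa using (tendsto_finsetSum _ fun (i : I) _ => (hcov i).const_mul (t i)).const_mul s
  have hexp : ∀ j, ((Real.exp (-(‖T (s • g j + w j)‖ ^ 2) / 2) : ℝ) : ℂ) =
      ((Real.exp (-(‖T (s • g j)‖ ^ 2) / 2) : ℝ) : ℂ) *
        ((Real.exp (-(‖T (w j)‖ ^ 2) / 2) : ℝ) : ℂ) *
        ((Real.exp (-⟪T (s • g j), T (w j)⟫) : ℝ) : ℂ) := fun j => by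
    rw [← Complex.ofReal_mul, ← Complex.ofReal_mul, ← Real.exp_add, ← Real.exp_add, map_add,
      norm_add_sq_real]
    congr 2
    ring
  simp_rw [hexp] at l1
  have hc' : Tendsto (fun j => ((Real.exp (-⟪T (s • g j), T (w j)⟫) : ℝ) : ℂ)) atTop (𝓝 1) := by
    have hcont : Continuous fun r : ℝ => ((Real.exp (-r) : ℝ) : ℂ) := by fun_prop
    have := (hcont.tendsto 0).comp hc
    rw [neg_zero, Real.exp_zero, Complex.ofReal_one] at this
    exact this
  have := tendsto_nhds_unique l1 ((l2.mul l3).mul hc')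
  simp only [ContinuousLinearMap.comp_apply, ContinuousLinearMap.inl_apply,
    ContinuousLinearMap.inr_apply, hL1, hL2]
  simp only [hL]
  rw [mul_one] at this
  exact this

/-- A sequence in a Gaussian family whose increments decay geometrically converges almost surely. -/
theorem ae_exists_tendsto [IsProbabilityMeasure Q] (hV : IsGaussianFamily V T Q) {g : ℕ → E} {C : ℝ}
    (hg : ∀ j, ‖T (g (j + 1) - g j)‖ ≤ C * (1 / 2) ^ j) :
    ∀ᵐ ω ∂Q, ∃ z, Tendsto (fun j => V (g j) ω) atTop (𝓝 z) := by
  have hC : 0 ≤ C := by simpa using (norm_nonneg _).trans (hg 0)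
  have hL2 : ∀ j, ∫⁻ ω, ‖V (g (j + 1) - g j) ω‖ₑ ∂Q ≤ ENNReal.ofReal (C * (1 / 2) ^ j) := by
    intro j
    set d := g (j + 1) - g j
    have h1 : ∫⁻ ω, ‖V d ω‖ₑ ^ (2 : ℝ) ∂Q = ENNReal.ofReal (‖T d‖ ^ 2) := by
      have := lintegral_add_const_sq_gaussianReal (‖T d‖₊ ^ 2) 0
      rw [← hV.map_eq, lintegral_map (by fun_prop) (hV.measurable d)] at this
      simp only [add_zero] at this
      rw [show ‖T d‖ ^ 2 = ((‖T d‖₊ ^ 2 : NNReal) : ℝ) + 0 ^ 2 by simp, ← this]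
      refine lintegral_congr fun ω => ?_
      rw [← sq_abs, ENNReal.ofReal_pow (abs_nonneg _), ← Real.enorm_eq_ofReal_abs]
      norm_cast
    have h2 := eLpNorm_le_eLpNorm_of_exponent_le (μ := Q) (p := 1) (q := 2) (by norm_num)
      (hV.measurable d).aestronglyMeasurable
    rw [eLpNorm_one_eq_lintegral_enorm, eLpNorm_eq_lintegral_rpow_enorm_toReal (by norm_num)
      (by norm_num)] at h2
    simp only [ENNReal.toReal_ofNat, h1] at h2
    refine h2.trans ?_
    rw [ENNReal.ofReal_rpow_of_nonneg (by positivity) (by positivity)]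
    refine ENNReal.ofReal_le_ofReal (le_trans (le_of_eq ?_) (hg j))
    rw [← Real.sqrt_eq_rpow, Real.sqrt_sq (norm_nonneg _)]
  -- The increments are summable in `L¹`, so almost surely they are absolutely summable, and the
  -- sequence converges by telescoping.
  have hsum : ∫⁻ ω, ∑' j, ‖V (g (j + 1) - g j) ω‖ₑ ∂Q ≠ ⊤ := by
    rw [lintegral_tsum fun j => (hV.measurable _).enorm.aemeasurable]
    refine ne_top_of_le_ne_top ?_ (ENNReal.tsum_le_tsum hL2)
    have hs : Summable fun j : ℕ => C * (1 / 2 : ℝ) ^ j :=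
      summable_geometric_two.mul_left C
    exact hs.tsum_ofReal_ne_top
  have hfin := ae_lt_top (Measurable.tsum fun j => (hV.measurable (g (j + 1) - g j)).enorm)
    hsum
  filter_upwards [hfin] with ω hω
  have hs : Summable fun j => V (g (j + 1) - g j) ω := by
    refine Summable.of_nnnorm ?_
    exact ENNReal.tsum_coe_ne_top_iff_summable.1 hω.ne
  have ht := hs.hasSum.tendsto_sum_nat
  refine ⟨(∑' j, V (g (j + 1) - g j) ω) + V (g 0) ω, ?_⟩
  refine (ht.add_const (V (g 0) ω)).congr fun n => ?_
  have : ∀ j, V (g (j + 1) - g j) ω = V (g (j + 1)) ω - V (g j) ω := fun j => by simp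
  simp_rw [this]
  rw [Finset.sum_range_sub (fun j => V (g j) ω)]
  ring

end IsGaussianFamily

/-! ### The noise as a Gaussian family -/

section Noise

variable {X : Type*} [NormedAddCommGroup X] [InnerProductSpace ℝ X]

/-- The functional `x ↦ ∑ₖ gₖ xₖ` of a sequence, for finitely supported coefficients. -/
noncomputable def finEval : (ℕ →₀ ℝ) →ₗ[ℝ] ((ℕ → ℝ) → ℝ) :=
  Finsupp.linearCombination ℝ fun k x => x k

/-- The vector `∑ₖ gₖ φₖ`, for finitely supported coefficients. -/
noncomputable def finVec (φ : HilbertBasis ℕ ℝ X) : (ℕ →₀ ℝ) →ₗ[ℝ] X :=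
  Finsupp.linearCombination ℝ φ

theorem finEval_apply (g : ℕ →₀ ℝ) (x : ℕ → ℝ) :
    finEval g x = ∑ k ∈ g.support, g k * x k := by
  simp [finEval, Finsupp.linearCombination_apply, Finsupp.sum]

theorem finVec_apply (φ : HilbertBasis ℕ ℝ X) (g : ℕ →₀ ℝ) :
    finVec φ g = ∑ k ∈ g.support, g k • φ k := by
  simp [finVec, Finsupp.linearCombination_apply, Finsupp.sum]

theorem finEval_single (k : ℕ) (x : ℕ → ℝ) : finEval (Finsupp.single k 1) x = x k := by
  simp [finEval]

theorem finVec_single (φ : HilbertBasis ℕ ℝ X) (k : ℕ) :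
    finVec φ (Finsupp.single k 1) = φ k := by
  simp [finVec]

theorem finEval_inner (φ : HilbertBasis ℕ ℝ X) (g : ℕ →₀ ℝ) (v : X) :
    finEval g (fun k => ⟪φ k, v⟫) = ⟪finVec φ g, v⟫ := by
  simp [finEval_apply, finVec_apply, sum_inner, inner_smul_left]

theorem finEval_add (g : ℕ →₀ ℝ) (x y : ℕ → ℝ) :
    finEval g (fun k => x k + y k) = finEval g x + finEval g y := by
  simp [finEval_apply, mul_add, Finset.sum_add_distrib]

theorem finEval_mul (g : ℕ →₀ ℝ) (c : ℝ) (x : ℕ → ℝ) :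
    finEval g (fun k => c * x k) = c * finEval g x := by
  simp only [finEval_apply, Finset.mul_sum]
  exact Finset.sum_congr rfl fun k _ => by ring

theorem measurable_finEval (g : ℕ →₀ ℝ) : Measurable (finEval g) := by
  have : finEval g = fun x => ∑ k ∈ g.support, g k * x k := funext (finEval_apply g)
  rw [this]
  fun_prop

/-- The pointwise limit of the functionals `finEval (g j)`, where it exists. -/
noncomputable def limEval (g : ℕ → ℕ →₀ ℝ) (x : ℕ → ℝ) : ℝ :=
  limsup (fun j => finEval (g j) x) atTop

/-- The `limsup` makes the functional measurable everywhere; its values off the set of convergence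
play no role. -/
theorem measurable_limEval (g : ℕ → ℕ →₀ ℝ) : Measurable (limEval g) :=
  Measurable.limsup fun j => measurable_finEval (g j)

theorem limEval_eq {g : ℕ → ℕ →₀ ℝ} {x : ℕ → ℝ} {z : ℝ}
    (h : Tendsto (fun j => finEval (g j) x) atTop (𝓝 z)) : limEval g x = z :=
  h.limsup_eq

/-- A positive square root of a positive-definite operator is symmetric and injective. -/
structure IsNoiseRoot (R : X →L[ℝ] X) : Prop where
  symm : ∀ x y, ⟪R x, y⟫ = ⟪x, R y⟫
  eq_zero : ∀ x, R x = 0 → x = 0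

theorem IsPosSqrt.isNoiseRoot [CompleteSpace X] {R C₁ : X →L[ℝ] X} (hR : IsPosSqrt R C₁)
    (hC₁ : IsPosDef C₁) : IsNoiseRoot R where
  symm x y := hR.isPositive.isSymmetric x y
  eq_zero x hx := by
    by_contra hne
    have := hC₁.pos x hne
    rw [← hR.comp_self] at this
    simp [hx] at this

theorem IsPosSqrt.inner_eq [CompleteSpace X] {R C₁ : X →L[ℝ] X} (hR : IsPosSqrt R C₁) (x y : X) :
    ⟪C₁ x, y⟫ = ⟪R x, R y⟫ := by
  rw [← hR.comp_self]
  exact hR.isPositive.isSymmetric (R x) y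

/-- Measuring variances by `‖R v‖` instead of `⟪C₁ v, v⟫` lets limits of these functionals be
labelled by any `h` in `X`, through `R v → h`. -/
theorem isGaussianFamily_finEval [CompleteSpace X] {R C₁ : X →L[ℝ] X} (φ : HilbertBasis ℕ ℝ X)
    (hRC : ∀ x y, ⟪C₁ x, y⟫ = ⟪R x, R y⟫) {P : Measure (ℕ → ℝ)} [IsProbabilityMeasure P]
    [MeasurableSpace X] [BorelSpace X] (hP : IsCenteredGaussianSeq P φ C₁) :
    IsGaussianFamily finEval (R.toLinearMap ∘ₗ finVec φ) P where
  measurable := measurable_finEval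
  map_eq g := by
    have hfun : finEval g = fun x => ∑ k ∈ g.support, g k * x k := funext (finEval_apply g)
    have hk : ∀ k, HasGaussianLaw (fun x : ℕ → ℝ => x k) P := fun k =>
      hP.isGaussian.hasGaussianLaw_eval k
    have hgauss : HasGaussianLaw (finEval g) P := by
      have := (hP.isGaussian.smul (fun k => g k)).hasGaussianLaw_fun_sum (I := g.support)
      rw [hfun]
      simpa using this
    have hLp : ∀ k, MemLp (fun x : ℕ → ℝ => g k * x k) 2 P := fun k =>
      (hk k).memLp_two.const_mul (g k)
    have hmean : ∫ x, finEval g x ∂P = 0 := by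
      rw [hfun, integral_finsetSum _ fun k _ => (hLp k).integrable (by norm_num)]
      simp [integral_const_mul, hP.mean]
    have hvar : Var[finEval g; P] = ‖R (finVec φ g)‖ ^ 2 := by
      rw [hfun, variance_fun_sum' fun k _ => hLp k, ← real_inner_self_eq_norm_sq, finVec_apply,
        map_sum, sum_inner]
      simp_rw [inner_sum]
      refine Finset.sum_congr rfl fun i _ => Finset.sum_congr rfl fun j _ => ?_
      rw [covariance_const_mul_left, covariance_const_mul_right, hP.cov, hRC]
      simp only [map_smul, inner_smul_left, inner_smul_right, conj_trivial]
      ring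
    rw [hgauss.map_eq_gaussianReal, hmean, hvar]
    congr 1
    ext
    simp [Real.coe_toNNReal _ (sq_nonneg _)]

/-- A vector `v` orthogonal to all `R (φ k)` has `R v = 0` by symmetry, so `v = 0`: the range is
dense. The geometric rate is what almost sure convergence of the functionals requires. -/
theorem IsNoiseRoot.exists_seq [CompleteSpace X] {R : X →L[ℝ] X} (hR : IsNoiseRoot R)
    (φ : HilbertBasis ℕ ℝ X) (h : X) :
    ∃ g : ℕ → ℕ →₀ ℝ, ∀ j, ‖R (finVec φ (g j)) - h‖ ≤ (1 / 2) ^ j := by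
  have hd : Dense ((LinearMap.range (R.toLinearMap ∘ₗ finVec φ) : Submodule ℝ X) : Set X) := by
    rw [Submodule.dense_iff_topologicalClosure_eq_top, Submodule.topologicalClosure_eq_top_iff,
      Submodule.eq_bot_iff]
    intro v hv
    rw [Submodule.mem_orthogonal] at hv
    refine hR.eq_zero v ?_
    have h0 : ∀ k, ⟪φ k, R v⟫ = 0 := fun k => by
      have := hv (R (φ k)) ⟨Finsupp.single k 1, by simp [finVec_single]⟩
      rwa [hR.symm] at this
    have : φ.repr (R v) = 0 := by
      ext k
      simp [φ.repr_apply_apply, h0]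
    simpa using this
  have : ∀ j : ℕ, ∃ g : ℕ →₀ ℝ, ‖R (finVec φ g) - h‖ ≤ (1 / 2) ^ j := fun j => by
    obtain ⟨y, hy, hd⟩ := Metric.mem_closure_iff.1 (hd h) ((1 / 2 : ℝ) ^ j) (by positivity)
    obtain ⟨g, rfl⟩ := hy
    refine ⟨g, ?_⟩
    rw [dist_comm, dist_eq_norm] at hd
    exact hd.le
  choose g hg using this
  exact ⟨g, hg⟩

theorem tendsto_of_norm_sub_le_geometric {E : Type*} [NormedAddCommGroup E] {f : ℕ → E} {h : E}
    (hf : ∀ j, ‖f j - h‖ ≤ (1 / 2) ^ j) : Tendsto f atTop (𝓝 h) := by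
  rw [tendsto_iff_norm_sub_tendsto_zero]
  exact squeeze_zero (fun _ => norm_nonneg _) hf
    (tendsto_pow_atTop_nhds_zero_of_lt_one (by norm_num) (by norm_num))

variable [CompleteSpace X] [MeasurableSpace X] [BorelSpace X]

/-- This gives a meaning to `⟨h, C₁^{-1/2} x⟩` for almost every noise sequence `x`, for any `h` in
`X`. -/
theorem ae_tendsto_limEval {R C₁ : X →L[ℝ] X} {φ : HilbertBasis ℕ ℝ X}
    (hRC : ∀ x y, ⟪C₁ x, y⟫ = ⟪R x, R y⟫) {P : Measure (ℕ → ℝ)} [IsProbabilityMeasure P]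
    (hP : IsCenteredGaussianSeq P φ C₁) {g : ℕ → ℕ →₀ ℝ} {h : X}
    (hg : ∀ j, ‖R (finVec φ (g j)) - h‖ ≤ (1 / 2) ^ j) :
    ∀ᵐ x ∂P, Tendsto (fun j => finEval (g j) x) atTop (𝓝 (limEval g x)) := by
  have := (isGaussianFamily_finEval φ hRC hP).ae_exists_tendsto (g := g) (C := 2) fun j => by
    calc ‖(R.toLinearMap ∘ₗ finVec φ) (g (j + 1) - g j)‖
        = ‖(R (finVec φ (g (j + 1))) - h) - (R (finVec φ (g j)) - h)‖ := by simp
      _ ≤ (1 / 2) ^ (j + 1) + (1 / 2) ^ j := (norm_sub_le _ _).trans (add_le_add (hg _) (hg _))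
      _ ≤ 2 * (1 / 2) ^ j := by
        rw [pow_succ]
        have : (0 : ℝ) ≤ (1 / 2) ^ j := by positivity
        linarith
  filter_upwards [this] with x hx
  obtain ⟨z, hz⟩ := hx
  rwa [limEval_eq hz]

/-- Shifts of the noise by elements of the range of `C₁^{1/2}` are absolutely continuous. -/
theorem map_add_absolutelyContinuous {R C₁ : X →L[ℝ] X} {φ : HilbertBasis ℕ ℝ X}
    (hR : IsNoiseRoot R) (hRC : ∀ x y, ⟪C₁ x, y⟫ = ⟪R x, R y⟫) {P : Measure (ℕ → ℝ)}
    [IsProbabilityMeasure P] (hP : IsCenteredGaussianSeq P φ C₁) (h : X) :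
    P.map (fun x k => x k + ⟪φ k, R h⟫) ≪ P := by
  rcases eq_or_ne h 0 with rfl | hne
  · simp only [map_zero, inner_zero_right, add_zero]
    rw [show (fun (x : ℕ → ℝ) k => x k) = id from rfl, Measure.map_id]
  have hn : ‖h‖ ^ 2 ≠ 0 := pow_ne_zero 2 (norm_ne_zero_iff.2 hne)
  obtain ⟨g, hg⟩ := hR.exists_seq φ h
  have hT : Tendsto (fun j => R (finVec φ (g j))) atTop (𝓝 h) := tendsto_of_norm_sub_le_geometric hg
  have hF := isGaussianFamily_finEval φ hRC hP
  have hlim := ae_tendsto_limEval hRC hP hg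
  -- `a` is the regression coefficient of the coordinates on `W = ⟨h, C₁^{-1/2} x⟩`, so the
  -- remainder `Y` is uncorrelated with `W`.
  set a : ℕ → ℝ := fun k => ⟪φ k, R h⟫ / ‖h‖ ^ 2 with ha
  set W := limEval g with hW
  have hWm : Measurable W := measurable_limEval g
  set Y : (ℕ → ℝ) → (ℕ → ℝ) := fun x k => x k - a k * W x with hY
  have hYm : ∀ k, Measurable fun x => Y x k := fun k => by
    simp only [hY]
    fun_prop
  have hYm' : Measurable Y := measurable_pi_lambda _ hYm
  have hind : IndepFun W Y P := by
    refine hF.indepFun_of_tendsto (Y := fun k x => Y x k)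
      (v := fun k j => Finsupp.single k 1 - a k • g j) hWm hYm hlim (fun k => ?_) (fun k => ?_)
    · filter_upwards [hlim] with x hx
      simp only [map_sub, map_smul, Pi.sub_apply, Pi.smul_apply, smul_eq_mul, finEval_single]
      exact (hx.const_mul (a k)).const_sub (x k)
    · have hc : Tendsto (fun j => ⟪R (finVec φ (g j)), R (φ k) - a k • R (finVec φ (g j))⟫) atTop
          (𝓝 ⟪h, R (φ k) - a k • h⟫) := hT.inner ((hT.const_smul (a k)).const_sub _)
      have h0 : ⟪h, R (φ k) - a k • h⟫ = 0 := by
        rw [inner_sub_right, inner_smul_right, real_inner_self_eq_norm_sq, ← hR.symm,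
          real_inner_comm]
        simp only [ha]
        field_simp
        ring
      rw [h0] at hc
      simpa [finVec_single] using hc
  have hlaw : P.map W = gaussianReal 0 (‖h‖₊ ^ 2) := hF.map_eq_of_tendsto hWm hT hlim
  have hv : ‖h‖₊ ^ 2 ≠ 0 := pow_ne_zero 2 (nnnorm_ne_zero_iff.2 hne)
  have := Measure.isProbabilityMeasure_map (μ := P) hYm'.aemeasurable
  have hjoint : P.map (fun x => (W x, Y x)) = (gaussianReal 0 (‖h‖₊ ^ 2)).prod (P.map Y) := by
    rw [← hlaw]
    exact (indepFun_iff_map_prod_eq_prod_map_map hWm.aemeasurable hYm'.aemeasurable).1 hind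
  set Φ : ℝ × (ℕ → ℝ) → (ℕ → ℝ) := fun p k => p.2 k + a k * p.1 with hΦ
  have hΦm : Measurable Φ := measurable_pi_lambda _ fun k => by
    simp only [hΦ]
    fun_prop
  have hP' : ((gaussianReal 0 (‖h‖₊ ^ 2)).prod (P.map Y)).map Φ = P := by
    rw [← hjoint, Measure.map_map hΦm (by fun_prop)]
    convert Measure.map_id
    ext x k
    simp [hΦ, hY]
  -- Adding `R h` to the noise amounts to adding `‖h‖²` to `W` with `Y` fixed, since `a k * ‖h‖² =
  -- ⟪φ k, R h⟫`. Only a one-dimensional nondegenerate Gaussian is shifted.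
  have hshift : P.map (fun x k => x k + ⟪φ k, R h⟫) =
      (((gaussianReal 0 (‖h‖₊ ^ 2)).map (fun s => s + ‖h‖ ^ 2)).prod (P.map Y)).map Φ := by
    conv_rhs => rw [← Measure.map_id (μ := P.map Y)]
    rw [Measure.map_prod_map _ _ (by fun_prop) measurable_id, ← hjoint,
      Measure.map_map hΦm (by fun_prop), Measure.map_map (by fun_prop) (by fun_prop)]
    congr 1
    ext x k
    simp only [hΦ, hY, ha, Function.comp, Prod.map, id]
    field_simp
    ring
  rw [hshift]
  nth_rewrite 2 [← hP']
  refine Measure.AbsolutelyContinuous.map (Measure.AbsolutelyContinuous.prod ?_ .rfl) hΦm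
  rw [gaussianReal_map_add_const]
  exact (gaussianReal_absolutelyContinuous _ hv).trans (gaussianReal_absolutelyContinuous' _ hv)

end Noise

/-! ### Conditional laws under a location structure -/

section Posterior

/-- Serves both the likelihood (parameter plus independent noise) and the candidate posterior (a
location `F y` plus an independent residual). -/
theorem compProd_map_prod_const {α β γ : Type*} [MeasurableSpace α] [MeasurableSpace β]
    [MeasurableSpace γ] (ν : Measure α) [SFinite ν] (ζ : Measure β) [IsProbabilityMeasure ζ]
    {Ψ : α × β → γ} (hΨ : Measurable Ψ) :
    ν ⊗ₘ ((Kernel.id ×ₖ Kernel.const α ζ).map Ψ) = (ν.prod ζ).map fun p => (p.1, Ψ p) := by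
  have := Kernel.IsMarkovKernel.map (Kernel.id ×ₖ Kernel.const α ζ) hΨ
  ext s hs
  have hm : Measurable fun p : α × β => (p.1, Ψ p) := by fun_prop
  rw [Measure.compProd_apply hs, Measure.map_apply hm hs, Measure.prod_apply (hm hs)]
  refine lintegral_congr fun a => ?_
  rw [Kernel.map_apply' _ hΨ _ (measurable_prodMk_left hs), Kernel.prod_apply, Kernel.id_apply,
    Kernel.const_apply, Measure.dirac_prod, Measure.map_apply (by fun_prop)
      (hΨ (measurable_prodMk_left hs))]
  rfl

/-- If `f u - F y` is independent of the data `y`, then the posterior law of `f u` given `y` is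
that of `F y + z`, where `z` has the law of `f u - F y`. -/
theorem posterior_map_ae_eq {α γ : Type*} [MeasurableSpace α] [StandardBorelSpace α] [Nonempty α]
    [MeasurableSpace γ] (κ : Kernel α γ) [IsMarkovKernel κ] (ν : Measure α)
    [IsProbabilityMeasure ν] {f : α → ℝ} {F : γ → ℝ} (hf : Measurable f) (hF : Measurable F)
    (hind : IndepFun (fun p : α × γ => f p.1 - F p.2) Prod.snd (ν ⊗ₘ κ)) :
    ∀ᵐ y ∂(κ ∘ₘ ν), ((posterior κ ν) y).map f =
      ((ν ⊗ₘ κ).map fun p => f p.1 - F p.2).map fun z => F y + z := by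
  set ζ : Measure ℝ := (ν ⊗ₘ κ).map fun p => f p.1 - F p.2 with hζ
  have hZ : Measurable fun p : α × γ => f p.1 - F p.2 := by fun_prop
  have : IsProbabilityMeasure ζ := Measure.isProbabilityMeasure_map hZ.aemeasurable
  have hΨ : Measurable fun p : γ × ℝ => F p.1 + p.2 := by fun_prop
  have := Kernel.IsMarkovKernel.map (Kernel.id ×ₖ Kernel.const γ ζ) hΨ
  have := Kernel.IsMarkovKernel.map (posterior κ ν) hf
  -- Both kernels disintegrate the joint law of `(y, f u)` over the marginal of `y`, so they agree
  -- almost everywhere.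
  have key : (κ ∘ₘ ν) ⊗ₘ ((posterior κ ν).map f) =
      (κ ∘ₘ ν) ⊗ₘ ((Kernel.id ×ₖ Kernel.const γ ζ).map fun p => F p.1 + p.2) := by
    have h1 : (ν ⊗ₘ κ).map (fun p => (p.2, f p.1 - F p.2)) = (κ ∘ₘ ν).prod ζ := by
      have := (indepFun_iff_map_prod_eq_prod_map_map measurable_snd.aemeasurable
        hZ.aemeasurable).1 hind.symm
      rw [this, ← Measure.snd_compProd]
      rfl
    rw [compProd_map_prod_const _ _ hΨ, ← h1, Measure.map_map (by fun_prop) (by fun_prop),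
      Measure.compProd_map hf, compProd_posterior_eq_map_swap,
      Measure.map_map (by fun_prop) measurable_swap]
    congr 1
    ext p <;> simp
  filter_upwards [Kernel.ae_eq_of_compProd_eq key] with y hy
  rw [← Kernel.map_apply _ hf, hy, Kernel.map_apply _ hΨ, Kernel.prod_apply, Kernel.id_apply,
    Kernel.const_apply, Measure.dirac_prod, Measure.map_map hΨ (by fun_prop)]
  rfl

/-- A bound on the posterior mean square error under a data law `ρ`. -/
theorem lintegral_posterior_sq_le {α γ : Type*} [MeasurableSpace α] [StandardBorelSpace α]
    [Nonempty α] [MeasurableSpace γ] (κ : Kernel α γ) [IsMarkovKernel κ] (ν : Measure α)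
    [IsProbabilityMeasure ν] {f : α → ℝ} {F : γ → ℝ} (hf : Measurable f) (hF : Measurable F)
    (hind : IndepFun (fun p : α × γ => f p.1 - F p.2) Prod.snd (ν ⊗ₘ κ))
    (ρ : Measure γ) [IsProbabilityMeasure ρ] (hρ : ρ ≪ κ ∘ₘ ν) (c : ℝ) :
    ∫⁻ y, ∫⁻ u, ENNReal.ofReal ((f u - c) ^ 2) ∂(posterior κ ν y) ∂ρ ≤
      2 * ∫⁻ y, ENNReal.ofReal ((F y - c) ^ 2) ∂ρ +
        2 * ∫⁻ p, ENNReal.ofReal ((f p.1 - F p.2) ^ 2) ∂(ν ⊗ₘ κ) := by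
  have hZ : Measurable fun p : α × γ => f p.1 - F p.2 := by fun_prop
  set ζ : Measure ℝ := (ν ⊗ₘ κ).map fun p => f p.1 - F p.2 with hζ
  have : IsProbabilityMeasure ζ := Measure.isProbabilityMeasure_map hZ.aemeasurable
  have hsq : ∫⁻ p, ENNReal.ofReal ((f p.1 - F p.2) ^ 2) ∂(ν ⊗ₘ κ) =
      ∫⁻ z, ENNReal.ofReal (z ^ 2) ∂ζ := by
    rw [hζ, lintegral_map (by fun_prop) hZ]
  rw [hsq]
  calc ∫⁻ y, ∫⁻ u, ENNReal.ofReal ((f u - c) ^ 2) ∂(posterior κ ν y) ∂ρ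
      ≤ ∫⁻ y, (2 * ENNReal.ofReal ((F y - c) ^ 2) + 2 * ∫⁻ z, ENNReal.ofReal (z ^ 2) ∂ζ) ∂ρ := by
        refine lintegral_mono_ae ?_
        filter_upwards [hρ.ae_le (posterior_map_ae_eq κ ν hf hF hind)] with y hy
        have h1 : ∫⁻ u, ENNReal.ofReal ((f u - c) ^ 2) ∂(posterior κ ν y) =
            ∫⁻ z, ENNReal.ofReal ((F y + z - c) ^ 2) ∂ζ := by
          rw [← lintegral_map (f := fun r : ℝ => ENNReal.ofReal ((r - c) ^ 2)) (by fun_prop) hf,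
            hy, lintegral_map (by fun_prop) (by fun_prop)]
        rw [h1]
        calc ∫⁻ z, ENNReal.ofReal ((F y + z - c) ^ 2) ∂ζ
            ≤ ∫⁻ z, (2 * ENNReal.ofReal ((F y - c) ^ 2) + 2 * ENNReal.ofReal (z ^ 2)) ∂ζ := by
              refine lintegral_mono fun z => ?_
              rw [← ENNReal.ofReal_ofNat, ← ENNReal.ofReal_mul (by norm_num),
                ← ENNReal.ofReal_mul (by norm_num), ← ENNReal.ofReal_add (by positivity)
                  (by positivity)]
              refine ENNReal.ofReal_le_ofReal ?_
              nlinarith [sq_nonneg (F y - c - z)]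
          _ = _ := by
              rw [lintegral_add_left (by fun_prop), lintegral_const, measure_univ, mul_one,
                lintegral_const_mul _ (by fun_prop)]
    _ = _ := by
        rw [lintegral_add_left (by fun_prop), lintegral_const, measure_univ, mul_one,
          lintegral_const_mul _ (by fun_prop)]

end Posterior

/-! ### The posterior error of a single coordinate -/

section Model

variable {X : Type*} [NormedAddCommGroup X] [InnerProductSpace ℝ X]

/-- The functionals `(u, x) ↦ ⟨a, u⟩ + ∑ₖ gₖ xₖ` of the parameter and the noise. -/
noncomputable def pairEval : (X × (ℕ →₀ ℝ)) →ₗ[ℝ] (X × (ℕ → ℝ) → ℝ) where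
  toFun q p := ⟪q.1, p.1⟫ + finEval q.2 p.2
  map_add' q q' := by
    ext p
    simp only [Prod.fst_add, Prod.snd_add, inner_add_left, map_add, Pi.add_apply]
    ring
  map_smul' c q := by
    ext p
    simp [inner_smul_left, mul_add]

/-- The image of the functional `pairEval (a, g)` in the product of the Cameron-Martin spaces. -/
noncomputable def pairVec (φ : HilbertBasis ℕ ℝ X) (D R : X →L[ℝ] X) (τ : ℝ) :
    (X × (ℕ →₀ ℝ)) →ₗ[ℝ] WithLp 2 (X × X) :=
  (WithLp.linearEquiv 2 ℝ (X × X)).symm.toLinearMap ∘ₗ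
    ((τ • D.toLinearMap).prodMap (R.toLinearMap ∘ₗ finVec φ))

theorem pairVec_apply (φ : HilbertBasis ℕ ℝ X) (D R : X →L[ℝ] X) (τ : ℝ) (q : X × (ℕ →₀ ℝ)) :
    pairVec φ D R τ q = WithLp.toLp 2 (τ • D q.1, R (finVec φ q.2)) := rfl

theorem sqrt_mul_dataOf (φ : HilbertBasis ℕ ℝ X) (K : X →L[ℝ] X) {n : ℕ} (hn : n ≠ 0)
    (g : ℕ →₀ ℝ) (u : X) (x : ℕ → ℝ) :
    finEval g (fun k => √(n : ℝ) * dataOf φ K n (u, x) k) =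
      √(n : ℝ) * ⟪finVec φ g, K u⟫ + finEval g x := by
  have hsn : √(n : ℝ) ≠ 0 := by positivity
  have : (fun k => √(n : ℝ) * dataOf φ K n (u, x) k) =
      fun k => √(n : ℝ) * ⟪φ k, K u⟫ + x k := by
    ext k
    simp only [dataOf]
    field_simp
  rw [this, finEval_add, finEval_mul, finEval_inner]

theorem compProd_likelihood [MeasurableSpace X] [BorelSpace X] (φ : HilbertBasis ℕ ℝ X)
    (K : X →L[ℝ] X) (ν : Measure X) [SFinite ν] (P : Measure (ℕ → ℝ)) [IsProbabilityMeasure P] (n : ℕ) :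
    ν ⊗ₘ likelihood φ K P n = (ν.prod P).map fun p => (p.1, dataOf φ K n p) :=
  compProd_map_prod_const ν P (measurable_dataOf φ K n)

/-- The data law at a parameter in the domain of `C₁^{-1/2} K` is absolutely continuous with
respect to the marginal law of the data. -/
theorem likelihood_absolutelyContinuous [CompleteSpace X] [MeasurableSpace X] [BorelSpace X]
    {μ : Measure X} [IsProbabilityMeasure μ] {C₁ K R : X →L[ℝ] X} {φ : HilbertBasis ℕ ℝ X} (hR : IsNoiseRoot R)
    (hRC : ∀ x y, ⟪C₁ x, y⟫ = ⟪R x, R y⟫) {P : Measure (ℕ → ℝ)} [IsProbabilityMeasure P]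
    (hP : IsCenteredGaussianSeq P φ C₁) {n : ℕ} (hn : n ≠ 0)
    (hgood : ∀ᵐ u ∂μ, ∃ w, R w = K u) {u' w' : X} (hu' : R w' = K u') :
    likelihood φ K P n u' ≪ likelihood φ K P n ∘ₘ μ := by
  refine Measure.AbsolutelyContinuous.mk fun s hs h0 => ?_
  rw [Measure.bind_apply hs (Kernel.aemeasurable _),
    lintegral_eq_zero_iff (Kernel.measurable_coe _ hs)] at h0
  -- A single parameter `u` suffices: its data law gives `s` mass zero, and `K u' - K u` lies in the
  -- range of `R`.
  obtain ⟨u, hu, w, hw⟩ := (h0.and hgood).exists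
  have hmeas : ∀ v : X, Measurable fun x => dataOf φ K n (v, x) := fun v =>
    (measurable_dataOf φ K n).comp measurable_prodMk_left
  have hsn : √(n : ℝ) ≠ 0 := by positivity
  simp only [Pi.zero_apply, likelihood_apply] at hu
  rw [Measure.map_apply (hmeas u) hs] at hu
  rw [likelihood_apply, Measure.map_apply (hmeas u') hs]
  have hac := map_add_absolutelyContinuous hR hRC hP (√(n : ℝ) • (w' - w)) hu
  rw [Measure.map_apply (by fun_prop) (hmeas u hs)] at hac
  convert hac using 2
  ext x
  simp only [Set.mem_preimage]
  have : dataOf φ K n (u', x) =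
      dataOf φ K n (u, fun k => x k + ⟪φ k, R (√(n : ℝ) • (w' - w))⟫) := by
    ext k
    simp only [dataOf, map_smul, map_sub, hu', hw, inner_smul_right, inner_sub_right]
    field_simp
    ring
  rw [this]

variable [CompleteSpace X] [SecondCountableTopology X] [MeasurableSpace X] [BorelSpace X]

instance isProbabilityMeasure_prior (μ : Measure X) [IsProbabilityMeasure μ] (τ : ℝ) :
    IsProbabilityMeasure (prior μ τ) :=
  Measure.isProbabilityMeasure_map (by fun_prop)

theorem map_inner_prior {μ : Measure X} [IsProbabilityMeasure μ] {C₀ D : X →L[ℝ] X}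
    (hμ : IsCenteredGaussian μ C₀) (hD : ∀ a b, ⟪C₀ a, b⟫ = ⟪D a, D b⟫) (τ : ℝ) (a : X) :
    (prior μ τ).map (fun u => ⟪a, u⟫) = gaussianReal 0 (‖τ • D a‖₊ ^ 2) := by
  have := hμ.isGaussian
  have hm : Measurable fun u : X => ⟪a, u⟫ := by fun_prop
  rw [prior, Measure.map_map hm (by fun_prop)]
  have hfun : (fun u : X => ⟪a, u⟫) ∘ (fun u => τ • u) = fun u => (τ • innerSL ℝ a) u := by
    ext u
    simp [inner_smul_right]
  have hg : HasGaussianLaw (fun u : X => (τ • innerSL ℝ a) u) μ :=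
    (IsGaussian.hasGaussianLaw_id (μ := μ)).map_fun (τ • innerSL ℝ a)
  rw [hfun, hg.map_eq_gaussianReal]
  have hid : Integrable (fun u : X => u) μ := IsGaussian.integrable_id
  have hmean : ∫ u, (τ • innerSL ℝ a) u ∂μ = 0 := by
    rw [ContinuousLinearMap.integral_comp_comm _ hid, hμ.mean, map_zero]
  have hvar : Var[fun u => (τ • innerSL ℝ a) u; μ] = ‖τ • D a‖ ^ 2 := by
    have h1 := hμ.cov a a
    rw [covarianceBilin_apply_eq_cov IsGaussian.memLp_two_id, covariance_self (by fun_prop), hD,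
      real_inner_self_eq_norm_sq] at h1
    simp only [smul_apply, innerSL_apply_apply, smul_eq_mul]
    rw [variance_const_mul, h1, norm_smul, mul_pow, Real.norm_eq_abs, sq_abs]
  rw [hmean, hvar]
  congr 1
  ext
  simp [Real.coe_toNNReal _ (sq_nonneg _)]

/-- Parameter and noise are independent, so variances add; this is the `L²` product norm of
`pairVec`. -/
theorem isGaussianFamily_pairEval {μ : Measure X} [IsProbabilityMeasure μ] {C₀ C₁ D R : X →L[ℝ] X}
    {φ : HilbertBasis ℕ ℝ X} (hμ : IsCenteredGaussian μ C₀) (hD : ∀ a b, ⟪C₀ a, b⟫ = ⟪D a, D b⟫)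
    (hRC : ∀ x y, ⟪C₁ x, y⟫ = ⟪R x, R y⟫) {P : Measure (ℕ → ℝ)} [IsProbabilityMeasure P]
    (hP : IsCenteredGaussianSeq P φ C₁) (τ : ℝ) :
    IsGaussianFamily pairEval (pairVec φ D R τ) ((prior μ τ).prod P) where
  measurable q := by
    have h1 : Measurable fun u : X => ⟪q.1, u⟫ := by fun_prop
    exact (h1.comp measurable_fst).add ((measurable_finEval q.2).comp measurable_snd)
  map_eq q := by
    have h1 : Measurable fun u : X => ⟪q.1, u⟫ := by fun_prop
    have h2 := measurable_finEval q.2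
    have hind : IndepFun (fun p : X × (ℕ → ℝ) => ⟪q.1, p.1⟫) (fun p => finEval q.2 p.2)
        ((prior μ τ).prod P) := indepFun_prod h1 h2
    have e1 : ((prior μ τ).prod P).map (fun p => ⟪q.1, p.1⟫) =
        gaussianReal 0 (‖τ • D q.1‖₊ ^ 2) := by
      rw [← map_inner_prior hμ hD, ← (measurePreserving_fst (μ := prior μ τ) (ν := P)).map_eq,
        Measure.map_map h1 measurable_fst, measurePreserving_fst.map_eq]
      rfl
    have e2 : ((prior μ τ).prod P).map (fun p => finEval q.2 p.2) =
        gaussianReal 0 (‖R (finVec φ q.2)‖₊ ^ 2) := by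
      have := (isGaussianFamily_finEval φ hRC hP).map_eq q.2
      simp only [LinearMap.comp_apply, ContinuousLinearMap.coe_coe] at this
      rw [← this, ← (measurePreserving_snd (μ := prior μ τ) (ν := P)).map_eq,
        Measure.map_map h2 measurable_snd, measurePreserving_snd.map_eq]
      rfl
    have := gaussianReal_add_gaussianReal_of_indepFun hind e1 e2
    rw [add_zero] at this
    have hv : ‖pairVec φ D R τ q‖₊ ^ 2 = ‖τ • D q.1‖₊ ^ 2 + ‖R (finVec φ q.2)‖₊ ^ 2 := by
      ext
      rw [pairVec_apply]
      push_cast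
      rw [WithLp.prod_norm_sq_eq_of_L2]
      rfl
    rw [hv, ← this]
    rfl

/-- The posterior mean square error of the `k`-th coordinate, where `D = C₀^{1/2}`,
`M = C₁^{-1/2} K D`, `p = (1 + n τ² M* M)⁻¹ φₖ` and the true parameter is `D z`. -/
theorem lintegral_posterior_coord_le {μ : Measure X} [IsProbabilityMeasure μ]
    {C₀ C₁ D K R M : X →L[ℝ] X} {φ : HilbertBasis ℕ ℝ X} (hμ : IsCenteredGaussian μ C₀)
    (hD : ∀ a b, ⟪C₀ a, b⟫ = ⟪D a, D b⟫) (hDs : ∀ a b, ⟪D a, b⟫ = ⟪a, D b⟫)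
    (hKs : ∀ a b, ⟪K a, b⟫ = ⟪a, K b⟫) (hR : IsNoiseRoot R)
    (hRC : ∀ x y, ⟪C₁ x, y⟫ = ⟪R x, R y⟫) {P : Measure (ℕ → ℝ)} [IsProbabilityMeasure P]
    (hP : IsCenteredGaussianSeq P φ C₁) (hM : ∀ z, R (M z) = K (D z)) {n : ℕ} (hn : n ≠ 0)
    {τ : ℝ} (hgood : ∀ᵐ u ∂(prior μ τ), ∃ w, R w = K u) {k : ℕ} {a : ℝ}
    (ha : D (φ k) = a • φ k) {p : X}
    (hp : p + (n * τ ^ 2 : ℝ) • M.adjoint (M p) = φ k) (z : X) :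
    ∫⁻ y, ∫⁻ u, ENNReal.ofReal ((⟪φ k, u⟫ - ⟪φ k, D z⟫) ^ 2) ∂(posteriorLaw φ K μ P n τ y)
        ∂(likelihood φ K P n (D z)) ≤
      ENNReal.ofReal (4 * (τ ^ 2 * a ^ 2 * ⟪φ k, p⟫) + 2 * (a ^ 2 * ⟪p, z⟫ ^ 2)) := by
  set r : ℝ := √(n : ℝ) with hr
  have hr0 : r ≠ 0 := by positivity
  have hrr : r * r = n := Real.mul_self_sqrt (by positivity)
  -- The posterior mean will be `√n ⟨h, C₁^{-1/2} y⟩`. The residual has representative `(τ a p, -h)`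
  -- and the `i`-th datum `(τ M* R φᵢ, n^{-1/2} R φᵢ)`; orthogonality of the two forces this `h`.
  set h : X := (τ ^ 2 * a * r) • M p with hh
  obtain ⟨g, hg⟩ := hR.exists_seq φ h
  have hT : Tendsto (fun j => R (finVec φ (g j))) atTop (𝓝 h) := tendsto_of_norm_sub_le_geometric hg
  have hlim := ae_tendsto_limEval hRC hP hg
  have hF := isGaussianFamily_finEval φ hRC hP
  have hV := isGaussianFamily_pairEval hμ hD hRC hP τ
  have hDK : ∀ x, D (K x) = M.adjoint (R x) := fun x => by
    refine ext_inner_right ℝ fun v => ?_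
    rw [hDs, hKs, ← hM, ContinuousLinearMap.adjoint_inner_left, ← hR.symm]
  -- the posterior mean of the coordinate
  set F : (ℕ → ℝ) → ℝ := fun y => limEval g fun k => r * y k with hFdef
  have hFm : Measurable F := (measurable_limEval g).comp (by fun_prop)
  have hFlim : ∀ u w, R w = K u → ∀ x,
      Tendsto (fun j => finEval (g j) x) atTop (𝓝 (limEval g x)) →
      Tendsto (fun j => r * ⟪finVec φ (g j), K u⟫ + finEval (g j) x) atTop
          (𝓝 (F (dataOf φ K n (u, x)))) ∧
        F (dataOf φ K n (u, x)) = r * ⟪h, w⟫ + limEval g x := by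
    intro u w hw x hx
    have h1 : Tendsto (fun j => r * ⟪finVec φ (g j), K u⟫ + finEval (g j) x) atTop
        (𝓝 (r * ⟪h, w⟫ + limEval g x)) := by
      refine Tendsto.add (Tendsto.const_mul r ?_) hx
      simp_rw [← hw, ← hR.symm]
      exact hT.inner tendsto_const_nhds
    have h2 : F (dataOf φ K n (u, x)) = r * ⟪h, w⟫ + limEval g x := by
      refine limEval_eq ?_
      simp_rw [hr, sqrt_mul_dataOf φ K hn]
      exact h1
    exact ⟨h2 ▸ h1, h2⟩
  have hpp : ⟪φ k, p⟫ = ‖p‖ ^ 2 + n * τ ^ 2 * ‖M p‖ ^ 2 := by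
    rw [← hp, inner_add_left, inner_smul_left, ContinuousLinearMap.adjoint_inner_left,
      real_inner_self_eq_norm_sq, real_inner_self_eq_norm_sq, conj_trivial]
  have hnh : ‖h‖ ^ 2 = τ ^ 2 * a ^ 2 * (n * τ ^ 2 * ‖M p‖ ^ 2) := by
    rw [hh, norm_smul, mul_pow, Real.norm_eq_abs, sq_abs, ← hrr]
    ring
  -- This is the resolvent equation for `p`: it identifies the parameter part of the residual.
  have hap : a • φ k - r • M.adjoint h = a • p := by
    rw [hh, map_smul, smul_smul, ← hp, smul_add, smul_smul, ← hrr]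
    have : a * (r * r * τ ^ 2) = r * (τ ^ 2 * a * r) := by ring
    rw [this, add_sub_cancel_right]
  -- the residual as a limit of elements of the Gaussian family
  set q : ℕ → X × (ℕ →₀ ℝ) := fun j => (φ k - r • K (finVec φ (g j)), -g j) with hq
  set Z : X × (ℕ → ℝ) → ℝ := fun s => ⟪φ k, s.1⟫ - F (dataOf φ K n s) with hZ
  have hinner : Measurable fun u : X => ⟪φ k, u⟫ := by fun_prop
  have hZm : Measurable Z :=
    (hinner.comp measurable_fst).sub (hFm.comp (measurable_dataOf φ K n))
  have hZlim : ∀ᵐ s ∂((prior μ τ).prod P),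
      Tendsto (fun j => pairEval (q j) s) atTop (𝓝 (Z s)) := by
    have e1 : ∀ᵐ s ∂((prior μ τ).prod P), ∃ w, R w = K s.1 :=
      Measure.quasiMeasurePreserving_fst.ae hgood
    have e2 : ∀ᵐ s ∂((prior μ τ).prod P),
        Tendsto (fun j => finEval (g j) s.2) atTop (𝓝 (limEval g s.2)) :=
      Measure.quasiMeasurePreserving_snd.ae hlim
    filter_upwards [e1, e2] with s ⟨w, hw⟩ hs
    have := ((hFlim s.1 w hw s.2 hs).1).const_sub ⟪φ k, s.1⟫
    refine this.congr fun j => ?_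
    simp only [hq, pairEval, LinearMap.coe_mk, AddHom.coe_mk, map_neg, Pi.neg_apply,
      inner_sub_left, inner_smul_left, hKs, conj_trivial]
    ring
  have hTq : Tendsto (fun j => pairVec φ D R τ (q j)) atTop
      (𝓝 (WithLp.toLp 2 (τ • a • p, -h))) := by
    have h1 : Tendsto (fun j => τ • (a • φ k - r • M.adjoint (R (finVec φ (g j))))) atTop
        (𝓝 (τ • a • p)) := by
      rw [← hap]
      exact ((((M.adjoint.continuous.tendsto h).comp hT).const_smul r).const_sub _).const_smul τ
    have h2 := ((WithLp.prod_continuous_toLp 2 X X).tendsto (τ • a • p, -h)).comp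
      (h1.prodMk_nhds hT.neg)
    refine h2.congr fun j => ?_
    simp only [hq, pairVec_apply, Function.comp, map_sub, map_smul, map_neg, ha, hDK]
  have hlawZ : ((prior μ τ).prod P).map Z =
      gaussianReal 0 (‖(WithLp.toLp 2 (τ • a • p, -h) : WithLp 2 (X × X))‖₊ ^ 2) :=
    hV.map_eq_of_tendsto hZm hTq hZlim
  have hnormZ : ‖(WithLp.toLp 2 (τ • a • p, -h) : WithLp 2 (X × X))‖ ^ 2 =
      τ ^ 2 * a ^ 2 * ⟪φ k, p⟫ := by
    rw [WithLp.prod_norm_sq_eq_of_L2]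
    simp only [WithLp.fst, WithLp.snd, norm_neg, hnh, norm_smul, mul_pow, Real.norm_eq_abs, sq_abs, hpp]
    ring
  have hindZ : IndepFun Z (fun s i => dataOf φ K n s i) ((prior μ τ).prod P) := by
    refine hV.indepFun_of_tendsto (Y := fun i s => dataOf φ K n s i)
      (v := fun i _ => (K (φ i), r⁻¹ • Finsupp.single i 1)) hZm
      (fun i => (measurable_pi_apply i).comp (measurable_dataOf φ K n)) hZlim
      (fun i => ae_of_all _ fun s => ?_) (fun i => ?_)
    · refine tendsto_const_nhds.congr fun j => ?_
      simp only [pairEval, LinearMap.coe_mk, AddHom.coe_mk, map_smul, Pi.smul_apply,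
        finEval_single, smul_eq_mul, dataOf, hKs, hr]
    · have := hTq.inner (𝕜 := ℝ)
        (tendsto_const_nhds (x := pairVec φ D R τ (K (φ i), r⁻¹ • Finsupp.single i 1)))
      convert this using 2
      rw [pairVec_apply, WithLp.prod_inner_apply]
      simp only [hDK, map_smul, finVec_single, inner_smul_left, inner_smul_right, conj_trivial,
        inner_neg_left, ContinuousLinearMap.adjoint_inner_right, hh]
      field_simp
      ring
  -- transfer to the joint law of parameter and data
  have hjoint := compProd_likelihood φ K (prior μ τ) P n
  have hpm : Measurable fun s : X × (ℕ → ℝ) => (s.1, dataOf φ K n s) :=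
    measurable_fst.prodMk (measurable_dataOf φ K n)
  have hfm : Measurable fun s : X × (ℕ → ℝ) => ⟪φ k, s.1⟫ - F s.2 :=
    (hinner.comp measurable_fst).sub (hFm.comp measurable_snd)
  have hind : IndepFun (fun s : X × (ℕ → ℝ) => ⟪φ k, s.1⟫ - F s.2) Prod.snd
      (prior μ τ ⊗ₘ likelihood φ K P n) := by
    rw [hjoint, indepFun_iff_map_prod_eq_prod_map_map hfm.aemeasurable measurable_snd.aemeasurable,
      Measure.map_map (hfm.prodMk measurable_snd) hpm, Measure.map_map hfm hpm,
      Measure.map_map measurable_snd hpm]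
    exact (indepFun_iff_map_prod_eq_prod_map_map hZm.aemeasurable
      (measurable_dataOf φ K n).aemeasurable).1 hindZ
  have hac : likelihood φ K P n (D z) ≪ likelihood φ K P n ∘ₘ prior μ τ :=
    likelihood_absolutelyContinuous hR hRC hP hn hgood (hM z)
  refine (lintegral_posterior_sq_le (likelihood φ K P n) (prior μ τ) hinner hFm hind _ hac
    ⟪φ k, D z⟫).trans ?_
  have hvarZ : ∫⁻ s, ENNReal.ofReal ((⟪φ k, s.1⟫ - F s.2) ^ 2)
      ∂(prior μ τ ⊗ₘ likelihood φ K P n) = ENNReal.ofReal (τ ^ 2 * a ^ 2 * ⟪φ k, p⟫) := by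
    rw [hjoint, lintegral_map (hfm.pow_const 2).ennreal_ofReal hpm]
    have e := lintegral_add_const_sq_gaussianReal
      (‖(WithLp.toLp 2 (τ • a • p, -h) : WithLp 2 (X × X))‖₊ ^ 2) 0
    rw [← hlawZ, lintegral_map (by fun_prop) hZm] at e
    push_cast at e
    rw [hnormZ] at e
    simpa [hZ] using e
  -- Testing the resolvent equation for `p` against `z` leaves only the resolvent term as bias.
  have hbias : r * ⟪h, M z⟫ - ⟪φ k, D z⟫ = -(a * ⟪p, z⟫) := by
    have e1 : ⟪φ k, D z⟫ = a * ⟪φ k, z⟫ := by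
      rw [← hDs, ha, inner_smul_left, conj_trivial]
    have e2 : ⟪φ k, z⟫ = ⟪p, z⟫ + n * τ ^ 2 * ⟪M p, M z⟫ := by
      rw [← hp, inner_add_left, inner_smul_left, ContinuousLinearMap.adjoint_inner_left,
        conj_trivial]
    rw [e1, e2, hh, inner_smul_left, conj_trivial, ← hrr]
    ring
  have hmean : ∫⁻ y, ENNReal.ofReal ((F y - ⟪φ k, D z⟫) ^ 2) ∂(likelihood φ K P n (D z)) =
      ENNReal.ofReal (‖h‖ ^ 2 + (a * ⟪p, z⟫) ^ 2) := by
    have e := lintegral_add_const_sq_gaussianReal (‖h‖₊ ^ 2) (-(a * ⟪p, z⟫))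
    have hlaw : P.map (limEval g) = gaussianReal 0 (‖h‖₊ ^ 2) :=
      hF.map_eq_of_tendsto (measurable_limEval g) hT hlim
    rw [← hlaw, lintegral_map (by fun_prop) (measurable_limEval g)] at e
    push_cast at e
    rw [neg_sq] at e
    have hdm : Measurable fun x => dataOf φ K n (D z, x) :=
      (measurable_dataOf φ K n).comp measurable_prodMk_left
    rw [← e, likelihood_apply, lintegral_map ((hFm.sub_const _).pow_const 2).ennreal_ofReal hdm]
    refine lintegral_congr_ae ?_
    filter_upwards [hlim] with x hx
    rw [(hFlim (D z) (M z) (hM z) x hx).2, ← hbias]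
    congr 2
    ring
  rw [hvarZ, hmean, ← ENNReal.ofReal_ofNat, ← ENNReal.ofReal_mul (by norm_num),
    ← ENNReal.ofReal_mul (by norm_num)]
  have hpos : 0 ≤ τ ^ 2 * a ^ 2 * ⟪φ k, p⟫ := by
    rw [hpp]
    positivity
  rw [← ENNReal.ofReal_add (by positivity) (by positivity)]
  refine ENNReal.ofReal_le_ofReal ?_
  -- The sampling variance of the posterior mean is at most the posterior variance, whence the
  -- factor `4 = 2 + 2`.
  have : ‖h‖ ^ 2 ≤ τ ^ 2 * a ^ 2 * ⟪φ k, p⟫ := by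
    rw [hnh, hpp]
    have : 0 ≤ τ ^ 2 * a ^ 2 * ‖p‖ ^ 2 := by positivity
    linarith
  nlinarith

end Model

/-! ### Operators diagonal in the basis, and the whitened forward operator -/

section Operators

variable {X : Type*} [NormedAddCommGroup X] [InnerProductSpace ℝ X]

theorem hasSum_inner_mul (φ : HilbertBasis ℕ ℝ X) (x y : X) :
    HasSum (fun k => ⟪φ k, x⟫ * ⟪φ k, y⟫) ⟪x, y⟫ := by
  simpa only [real_inner_comm] using φ.hasSum_inner_mul_inner x y

theorem hasSum_inner_sq (φ : HilbertBasis ℕ ℝ X) (x : X) :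
    HasSum (fun k => ⟪φ k, x⟫ ^ 2) (‖x‖ ^ 2) := by
  simpa only [sq, real_inner_self_eq_norm_mul_norm] using hasSum_inner_mul φ x x

theorem ext_inner_basis (φ : HilbertBasis ℕ ℝ X) {x y : X} (h : ∀ k, ⟪φ k, x⟫ = ⟪φ k, y⟫) :
    x = y := by
  refine φ.repr.injective ?_
  ext k
  simp [φ.repr_apply_apply, h]

theorem exists_of_summable_sq (φ : HilbertBasis ℕ ℝ X) {a : ℕ → ℝ}
    (ha : Summable fun k => a k ^ 2) : ∃ x : X, ∀ k, ⟪φ k, x⟫ = a k := by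
  have hm : Memℓp a 2 := by
    rw [memℓp_gen_iff (by norm_num)]
    simpa using ha
  refine ⟨φ.repr.symm ⟨a, hm⟩, fun k => ?_⟩
  rw [← φ.repr_apply_apply]
  simp

theorem exists_diagonal (φ : HilbertBasis ℕ ℝ X) {d : ℕ → ℝ} {B : ℝ} (hB : ∀ k, |d k| ≤ B) :
    ∃ D : X →L[ℝ] X, ∀ k x, ⟪φ k, D x⟫ = d k * ⟪φ k, x⟫ := by
  have hB0 : 0 ≤ B := (abs_nonneg _).trans (hB 0)
  have hT : ∀ k, ‖d k • ContinuousLinearMap.id ℝ ℝ‖ ≤ B := fun k => by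
    simpa [norm_smul] using hB k
  refine ⟨φ.repr.symm.toContinuousLinearEquiv.toContinuousLinearMap ∘L
    lp.mapCLM 2 (fun k => d k • ContinuousLinearMap.id ℝ ℝ) hB0 hT ∘L
    φ.repr.toContinuousLinearEquiv.toContinuousLinearMap, fun k x => ?_⟩
  rw [← φ.repr_apply_apply, ← φ.repr_apply_apply]
  simp [lp.mapCLM]

theorem diagonal_symm {φ : HilbertBasis ℕ ℝ X} {d : ℕ → ℝ} {D : X →L[ℝ] X}
    (hD : ∀ k x, ⟪φ k, D x⟫ = d k * ⟪φ k, x⟫) (x y : X) : ⟪D x, y⟫ = ⟪x, D y⟫ := by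
  refine (hasSum_inner_mul φ (D x) y).unique ?_
  convert hasSum_inner_mul φ x (D y) using 2 with k
  rw [hD, hD]
  ring

theorem inner_eigen {φ : HilbertBasis ℕ ℝ X} {C : X →L[ℝ] X} {κ : ℕ → ℝ}
    (hC : ∀ x y, ⟪C x, y⟫ = ⟪x, C y⟫) (hφ : ∀ k, C (φ k) = κ k • φ k) (k : ℕ) (x : X) :
    ⟪φ k, C x⟫ = κ k * ⟪φ k, x⟫ := by
  rw [← hC, hφ, inner_smul_left, conj_trivial]

theorem IsPosDefWithInverse.symm [CompleteSpace X] {A : X →ₗ.[ℝ] X} {K : X →L[ℝ] X}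
    (hA : IsPosDefWithInverse A K) (x y : X) : ⟪K x, y⟫ = ⟪x, K y⟫ := by
  have hform := LinearPMap.adjoint_isFormalAdjoint hA.isSelfAdjoint.dense_domain
  rw [LinearPMap.isSelfAdjoint_def.1 hA.isSelfAdjoint] at hform
  obtain ⟨hx, ex⟩ := hA.right_inv x
  obtain ⟨hy, ey⟩ := hA.right_inv y
  have := hform ⟨K x, hx⟩ ⟨K y, hy⟩
  rw [ex, ey] at this
  exact this.symm

/-- `1 + t M* M` is onto. -/
theorem exists_add_smul_adjoint_eq [CompleteSpace X] (M : X →L[ℝ] X) {t : ℝ} (ht : 0 ≤ t) (z : X) :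
    ∃ x, x + t • M.adjoint (M x) = z := by
  have hu : IsUnit (ContinuousLinearMap.id ℝ X + t • (M.adjoint ∘L M)) := by
    refine ContinuousLinearMap.isUnit_of_forall_le_norm_inner_map _ (c := 1) one_pos fun x => ?_
    have : ⟪(ContinuousLinearMap.id ℝ X + t • (M.adjoint ∘L M)) x, x⟫ =
        ‖x‖ ^ 2 + t * ‖M x‖ ^ 2 := by
      simp [inner_add_left, inner_smul_left, ContinuousLinearMap.adjoint_inner_left]
    rw [this, Real.norm_of_nonneg (by positivity)]
    have : 0 ≤ t * ‖M x‖ ^ 2 := by positivity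
    simpa using this
  obtain ⟨x, hx⟩ := (ContinuousLinearMap.isUnit_iff_bijective.1 hu).2 z
  exact ⟨x, by simpa using hx⟩

theorem summable_rpow_mul_inner_sq (φ : HilbertBasis ℕ ℝ X) {κ : ℕ → ℝ} {B : ℝ}
    (hκ : ∀ k, 0 < κ k) (hB : ∀ k, κ k ≤ B) {s : ℝ} (hs : 0 ≤ s) (x : X) :
    Summable fun k => κ k ^ s * ⟪φ k, x⟫ ^ 2 := by
  refine Summable.of_nonneg_of_le (fun k => ?_) (fun k => ?_)
    ((hasSum_inner_sq φ x).summable.mul_left (B ^ s))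
  · have := hκ k
    positivity
  · exact mul_le_mul_of_nonneg_right (Real.rpow_le_rpow (hκ k).le (hB k) hs) (sq_nonneg _)

/-- The whitened forward operator `M = C₁^{-1/2} K C₀^{1/2}`. -/
theorem exists_whitened_forward {φ : HilbertBasis ℕ ℝ X} {κ : ℕ → ℝ} {B : ℝ} {R K D : X →L[ℝ] X}
    (hκ : ∀ k, 0 < κ k) (hB : ∀ k, κ k ≤ B) (hR : IsNoiseRoot R)
    (hD : ∀ k x, ⟪φ k, D x⟫ = √(κ k) * ⟪φ k, x⟫) {Δ : ℝ} (hΔ : 0 < Δ)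
    (hfwd : ∃ c > 0, ∃ c' > 0, ∀ u : X, MemScale φ κ (1 - Δ) u →
      ∃ w : X, R w = K u ∧ c * ‖w‖ ≤ scaleNorm φ κ (1 - Δ) u ∧
        scaleNorm φ κ (1 - Δ) u ≤ c' * ‖w‖) :
    ∃ M : X →L[ℝ] X, (∀ z, R (M z) = K (D z)) ∧
      ∃ c > 0, c ≤ 1 ∧ ∀ z, c * ∑' k, κ k ^ Δ * ⟪φ k, z⟫ ^ 2 ≤ ‖M z‖ ^ 2 := by
  obtain ⟨c, hc, c', hc', hf⟩ := hfwd
  -- `D` gains one order on the scale, so the `X^{1-Δ}` norm of `D z` carries the weights `κₖ^Δ`.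
  have hterm : ∀ z k, κ k ^ (-(1 - Δ)) * ⟪φ k, D z⟫ ^ 2 = κ k ^ Δ * ⟪φ k, z⟫ ^ 2 := fun z k => by
    rw [hD, mul_pow, Real.sq_sqrt (hκ k).le, ← mul_assoc, ← Real.rpow_add_one (hκ k).ne']
    congr 2
    ring
  have hmem : ∀ z, MemScale φ κ (1 - Δ) (D z) := fun z => by
    simp only [MemScale, hterm]
    exact summable_rpow_mul_inner_sq φ hκ hB hΔ.le z
  have hnorm : ∀ z, scaleNorm φ κ (1 - Δ) (D z) = √(∑' k, κ k ^ Δ * ⟪φ k, z⟫ ^ 2) := fun z => by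
    simp only [scaleNorm, hterm]
  choose m hm1 hm2 hm3 using fun z => hf (D z) (hmem z)
  -- Injectivity of `R` makes the chosen preimages unique, hence linear in `z`.
  have hinj : ∀ x y, R x = R y → x = y := fun x y h => by
    rw [← sub_eq_zero]
    exact hR.eq_zero _ (by rw [map_sub, h, sub_self])
  have hB0 : 0 ≤ B := (hκ 0).le.trans (hB 0)
  have hbound : ∀ z, ‖m z‖ ≤ c⁻¹ * √(B ^ Δ) * ‖z‖ := fun z => by
    have h1 : ∑' k, κ k ^ Δ * ⟪φ k, z⟫ ^ 2 ≤ B ^ Δ * ‖z‖ ^ 2 := by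
      rw [← (hasSum_inner_sq φ z).tsum_eq, ← tsum_mul_left]
      exact (summable_rpow_mul_inner_sq φ hκ hB hΔ.le z).tsum_le_tsum (fun k =>
        mul_le_mul_of_nonneg_right (Real.rpow_le_rpow (hκ k).le (hB k) hΔ.le) (sq_nonneg _))
        ((hasSum_inner_sq φ z).summable.mul_left _)
    have h2 := (hm2 z).trans ((hnorm z).le.trans (Real.sqrt_le_sqrt h1))
    rw [Real.sqrt_mul (by positivity), Real.sqrt_sq (norm_nonneg _)] at h2
    rw [mul_assoc, inv_mul_eq_div, le_div_iff₀ hc, mul_comm]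
    exact h2
  refine ⟨LinearMap.mkContinuous
    { toFun := m
      map_add' := fun x y => hinj _ _ (by simp [hm1])
      map_smul' := fun a x => hinj _ _ (by simp [hm1]) } _ hbound, hm1,
    min 1 ((c' ^ 2)⁻¹), by positivity, min_le_left _ _, fun z => ?_⟩
  have hS : 0 ≤ ∑' k, κ k ^ Δ * ⟪φ k, z⟫ ^ 2 := tsum_nonneg fun k => by
    have := hκ k
    positivity
  have h1 : ∑' k, κ k ^ Δ * ⟪φ k, z⟫ ^ 2 ≤ c' ^ 2 * ‖m z‖ ^ 2 := by
    have := hm3 z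
    rw [hnorm, Real.sqrt_le_left (by positivity)] at this
    linarith [mul_pow c' ‖m z‖ 2]
  calc min 1 ((c' ^ 2)⁻¹) * ∑' k, κ k ^ Δ * ⟪φ k, z⟫ ^ 2
      ≤ (c' ^ 2)⁻¹ * ∑' k, κ k ^ Δ * ⟪φ k, z⟫ ^ 2 :=
        mul_le_mul_of_nonneg_right (min_le_right _ _) hS
    _ ≤ ‖m z‖ ^ 2 := by rwa [inv_mul_le_iff₀ (by positivity)]

end Operators

/-! ### Variance and bias -/

section Bounds

variable {X : Type*} [NormedAddCommGroup X] [InnerProductSpace ℝ X] [CompleteSpace X]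

theorem rpow_le_one_add {y θ : ℝ} (hy : 0 ≤ y) (h0 : 0 ≤ θ) (h1 : θ ≤ 1) : y ^ θ ≤ 1 + y := by
  rcases le_total y 1 with h | h
  · linarith [Real.rpow_le_one hy h h0]
  · linarith [Real.rpow_le_self_of_one_le h h1]

/-- The interpolation inequality `κ^{Δ θ} ≤ t^{-θ} (1 + t κ^Δ)`. -/
theorem rpow_mul_le_interp {κ t Δ θ : ℝ} (hκ : 0 < κ) (ht : 0 < t) (h0 : 0 ≤ θ) (h1 : θ ≤ 1) :
    κ ^ (Δ * θ) ≤ t ^ (-θ) * (1 + t * κ ^ Δ) := by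
  have := rpow_le_one_add (y := t * κ ^ Δ) (by positivity) h0 h1
  rw [Real.mul_rpow ht.le (by positivity), ← Real.rpow_mul hκ.le] at this
  rw [Real.rpow_neg ht.le, inv_mul_eq_div, le_div_iff₀ (by positivity), mul_comm]
  exact this

variable {φ : HilbertBasis ℕ ℝ X} {κ : ℕ → ℝ} {B : ℝ} {M : X →L[ℝ] X} {Δ c t : ℝ}

/-- Pair the equation with `x`. The bound `c ≤ 1` allows the same constant in front of `‖x‖²`. -/
theorem energy_le (ht : 0 ≤ t) (hc1 : c ≤ 1)
    (hM : ∀ z, c * ∑' k, κ k ^ Δ * ⟪φ k, z⟫ ^ 2 ≤ ‖M z‖ ^ 2) {x z : X}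
    (hx : x + t • M.adjoint (M x) = z) :
    c * (‖x‖ ^ 2 + t * ∑' k, κ k ^ Δ * ⟪φ k, x⟫ ^ 2) ≤ ⟪z, x⟫ := by
  have h1 : ⟪z, x⟫ = ‖x‖ ^ 2 + t * ‖M x‖ ^ 2 := by
    rw [← hx, inner_add_left, inner_smul_left, ContinuousLinearMap.adjoint_inner_left]
    simp
  rw [h1]
  have h2 := mul_le_mul_of_nonneg_left (hM x) ht
  have h3 : c * ‖x‖ ^ 2 ≤ ‖x‖ ^ 2 := by nlinarith [sq_nonneg ‖x‖]
  nlinarith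

/-- Keeping only the `k`-th term of the energy gives `c (1 + t κₖ^Δ) a² ≤ a` for `a = ⟪φ k, p⟫`, so
`a` is bounded as if `M` were diagonal; interpolation does the rest. -/
theorem posterior_variance_le (hκ : ∀ k, 0 < κ k) (hB : ∀ k, κ k ≤ B) (hΔ : 0 < Δ) (ht : 0 < t)
    (hc : 0 < c) (hc1 : c ≤ 1)
    (hM : ∀ z, c * ∑' k, κ k ^ Δ * ⟪φ k, z⟫ ^ 2 ≤ ‖M z‖ ^ 2) {k : ℕ} {p : X}
    (hp : p + t • M.adjoint (M p) = φ k) {ϑ : ℝ} (h0 : 0 ≤ ϑ) (h1 : ϑ ≤ 1) :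
    κ k * ⟪φ k, p⟫ ≤ c⁻¹ * t ^ (-ϑ) * κ k ^ (1 - Δ * ϑ) := by
  have hs := summable_rpow_mul_inner_sq φ hκ hB hΔ.le p
  have hk := hκ k
  have hS := hs.le_tsum k fun j _ => by
    have := hκ j
    positivity
  have hN := (hasSum_inner_sq φ p).summable.le_tsum k fun j _ => sq_nonneg _
  rw [(hasSum_inner_sq φ p).tsum_eq] at hN
  have hE := energy_le ht.le hc1 hM hp
  set a := ⟪φ k, p⟫
  have hE' : c * (1 + t * κ k ^ Δ) * a ^ 2 ≤ a := by
    refine le_trans ?_ hE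
    have := mul_le_mul_of_nonneg_left hS ht.le
    rw [mul_assoc]
    refine mul_le_mul_of_nonneg_left ?_ hc.le
    nlinarith
  have hY : 0 < 1 + t * κ k ^ Δ := by positivity
  have ha : c * (1 + t * κ k ^ Δ) * a ≤ 1 := by
    rcases le_or_gt a 0 with h | h
    · have : 0 ≤ c * (1 + t * κ k ^ Δ) := by positivity
      nlinarith
    · refine le_of_mul_le_mul_right ?_ h
      nlinarith
  have hi := rpow_mul_le_interp (Δ := Δ) hk ht h0 h1
  rw [Real.rpow_sub hk, Real.rpow_one]
  have hkp : 0 < κ k ^ (Δ * ϑ) := by positivity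
  have ha' : a ≤ c⁻¹ * (1 + t * κ k ^ Δ)⁻¹ := by
    rw [← mul_inv, ← one_div, le_div_iff₀ (by positivity)]
    linarith
  have hfin : (1 + t * κ k ^ Δ)⁻¹ ≤ t ^ (-ϑ) / κ k ^ (Δ * ϑ) := by
    rw [le_div_iff₀ hkp, inv_mul_le_iff₀ hY]
    linarith
  calc κ k * a ≤ κ k * (c⁻¹ * (t ^ (-ϑ) / κ k ^ (Δ * ϑ))) :=
        mul_le_mul_of_nonneg_left (ha'.trans
          (mul_le_mul_of_nonneg_left hfin (by positivity))) hk.le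
    _ = _ := by ring

/-- The energy `E` of `x` controls every intermediate norm by interpolation. It is used twice: at
`θ`, to bound `E` through the smoothness of `z`, and at `σ`, to pass from `E` to the norm of `D x`.
-/
theorem bias_le (hκ : ∀ k, 0 < κ k) (hB : ∀ k, κ k ≤ B) (hΔ : 0 < Δ) (ht : 0 < t)
    (hc : 0 < c) (hc1 : c ≤ 1)
    (hM : ∀ z, c * ∑' k, κ k ^ Δ * ⟪φ k, z⟫ ^ 2 ≤ ‖M z‖ ^ 2) {x z w : X}
    (hx : x + t • M.adjoint (M x) = z) {θ : ℝ} (h0 : 0 ≤ θ) (h1 : θ ≤ 1)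
    (hz : ∀ k, ⟪φ k, z⟫ = κ k ^ (Δ * θ / 2) * ⟪φ k, w⟫) {σ L : ℝ} (hσ0 : 0 ≤ σ) (hσ1 : σ ≤ 1)
    (hL : ∀ k, κ k ≤ L * κ k ^ (Δ * σ)) :
    ∑' k, κ k * ⟪φ k, x⟫ ^ 2 ≤ L * t ^ (-(σ + θ)) * (‖w‖ ^ 2 / c ^ 2) := by
  set S := ∑' k, κ k ^ Δ * ⟪φ k, x⟫ ^ 2 with hSdef
  set E := ‖x‖ ^ 2 + t * S with hEdef
  have hs : HasSum (fun k => (1 + t * κ k ^ Δ) * ⟪φ k, x⟫ ^ 2) E := by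
    have := (hasSum_inner_sq φ x).add
      ((summable_rpow_mul_inner_sq φ hκ hB hΔ.le x).hasSum.mul_left t)
    convert this using 2 with k
    ring
  have hinterp : ∀ {ρ : ℝ}, 0 ≤ ρ → ρ ≤ 1 →
      ∑' k, κ k ^ (Δ * ρ) * ⟪φ k, x⟫ ^ 2 ≤ t ^ (-ρ) * E := by
    intro ρ hρ0 hρ1
    rw [← (hs.mul_left (t ^ (-ρ))).tsum_eq]
    refine (summable_rpow_mul_inner_sq φ hκ hB (by positivity) x).tsum_le_tsum (fun k => ?_)
      (hs.mul_left _).summable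
    rw [← mul_assoc]
    exact mul_le_mul_of_nonneg_right (rpow_mul_le_interp (hκ k) ht hρ0 hρ1) (sq_nonneg _)
  have hE := energy_le ht.le hc1 hM hx
  have hEle : E ≤ t ^ (-θ) * (‖w‖ ^ 2 / c ^ 2) := by
    have htp : 0 < t ^ (-θ) := Real.rpow_pos_of_pos ht _
    have hsum1 := (hasSum_inner_sq φ w).mul_left (t ^ (-θ) / c)
    have hsum2 := (summable_rpow_mul_inner_sq φ hκ hB (s := Δ * θ) (by positivity) x).hasSum.mul_left
      (c / t ^ (-θ))
    -- Young's inequality, weighted so that the last sum is at most `c * E` and is absorbed by `2 *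
    -- c * E ≤ 2 * ⟪z, x⟫`.
    have hzx : 2 * ⟪z, x⟫ ≤ t ^ (-θ) / c * ‖w‖ ^ 2 +
        c / t ^ (-θ) * ∑' k, κ k ^ (Δ * θ) * ⟪φ k, x⟫ ^ 2 := by
      refine hasSum_le (fun k => ?_) ((hasSum_inner_mul φ z x).mul_left 2) (hsum1.add hsum2)
      have hsq : κ k ^ (Δ * θ) = (κ k ^ (Δ * θ / 2)) ^ 2 := by
        rw [← Real.rpow_natCast, ← Real.rpow_mul (hκ k).le]
        congr 1
        push_cast
        ring
      rw [hz, hsq]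
      set b := κ k ^ (Δ * θ / 2) * ⟪φ k, x⟫ with hb
      set q := t ^ (-θ) / c with hq
      have hq0 : 0 < q := by positivity
      have hqi : c / t ^ (-θ) = q⁻¹ := by rw [hq, inv_div]
      have e : q * ⟪φ k, w⟫ ^ 2 + q⁻¹ * b ^ 2 - 2 * (b * ⟪φ k, w⟫) =
          q⁻¹ * (q * ⟪φ k, w⟫ - b) ^ 2 := by
        field_simp
        ring
      have e' : 0 ≤ q⁻¹ * (q * ⟪φ k, w⟫ - b) ^ 2 := by positivity
      rw [hqi, ← mul_pow]
      have e2 : κ k ^ (Δ * θ / 2) * ⟪φ k, w⟫ * ⟪φ k, x⟫ = b * ⟪φ k, w⟫ := by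
        rw [hb]
        ring
      rw [e2]
      linarith
    have h3 : c / t ^ (-θ) * ∑' k, κ k ^ (Δ * θ) * ⟪φ k, x⟫ ^ 2 ≤ c * E := by
      rw [div_mul_eq_mul_div, div_le_iff₀ htp, mul_assoc]
      refine mul_le_mul_of_nonneg_left ?_ hc.le
      exact (hinterp h0 h1).trans_eq (mul_comm _ _)
    have h4 : c * E ≤ t ^ (-θ) / c * ‖w‖ ^ 2 := by linarith
    have h5 : E ≤ c⁻¹ * (t ^ (-θ) / c * ‖w‖ ^ 2) := by
      rw [← div_eq_inv_mul, le_div_iff₀ hc]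
      linarith
    refine h5.trans (le_of_eq ?_)
    field_simp
  have hL0 : 0 ≤ L := by
    by_contra hneg
    have h6 := hL 0
    have h7 : 0 < κ 0 ^ (Δ * σ) := Real.rpow_pos_of_pos (hκ 0) _
    nlinarith [hκ 0]
  have hs1 : Summable fun k => κ k * ⟪φ k, x⟫ ^ 2 := by
    simpa using summable_rpow_mul_inner_sq φ hκ hB zero_le_one x
  calc ∑' k, κ k * ⟪φ k, x⟫ ^ 2 ≤ ∑' k, L * (κ k ^ (Δ * σ) * ⟪φ k, x⟫ ^ 2) := by
        refine hs1.tsum_le_tsum (fun k => ?_)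
          ((summable_rpow_mul_inner_sq φ hκ hB (by positivity) x).mul_left L)
        rw [← mul_assoc]
        exact mul_le_mul_of_nonneg_right (hL k) (sq_nonneg _)
    _ ≤ L * (t ^ (-σ) * (t ^ (-θ) * (‖w‖ ^ 2 / c ^ 2))) := by
        rw [tsum_mul_left]
        exact mul_le_mul_of_nonneg_left ((hinterp hσ0 hσ1).trans
          (mul_le_mul_of_nonneg_left hEle (Real.rpow_nonneg ht.le _))) hL0
    _ = _ := by
        rw [neg_add, Real.rpow_add ht]
        ring

end Bounds

/-! ### Posterior contraction -/

section Contraction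

variable {X : Type*} [NormedAddCommGroup X] [InnerProductSpace ℝ X]

theorem IsPosDef.eigenvalue_pos [CompleteSpace X] {C : X →L[ℝ] X} {φ : HilbertBasis ℕ ℝ X}
    {κ : ℕ → ℝ} (hC : IsPosDef C) (hφ : ∀ k, C (φ k) = κ k • φ k) (k : ℕ) : 0 < κ k := by
  have := hC.pos (φ k) (φ.orthonormal.ne_zero k)
  rwa [hφ, inner_smul_left, real_inner_self_eq_norm_sq, φ.orthonormal.1 k, one_pow, mul_one,
    conj_trivial] at this

theorem eigenvalue_le_opNorm {C : X →L[ℝ] X} {φ : HilbertBasis ℕ ℝ X} {κ : ℕ → ℝ}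
    (hφ : ∀ k, C (φ k) = κ k • φ k) (k : ℕ) : κ k ≤ ‖C‖ := by
  have := C.le_opNorm (φ k)
  rw [hφ, norm_smul, φ.orthonormal.1 k, mul_one, mul_one] at this
  exact (le_abs_self _).trans this

theorem diagonal_apply_basis {φ : HilbertBasis ℕ ℝ X} {d : ℕ → ℝ} {D : X →L[ℝ] X}
    (hD : ∀ k x, ⟪φ k, D x⟫ = d k * ⟪φ k, x⟫) (k : ℕ) : D (φ k) = d k • φ k := by
  refine ext_inner_basis φ fun j => ?_
  rw [hD, inner_smul_right]
  rcases eq_or_ne j k with rfl | h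
  · rfl
  · simp [φ.orthonormal.2 h]

theorem MemScale.mono {φ : HilbertBasis ℕ ℝ X} {κ : ℕ → ℝ} {B : ℝ} (hκ : ∀ k, 0 < κ k)
    (hB : ∀ k, κ k ≤ B) {s t : ℝ} (hst : s ≤ t) {u : X} (h : MemScale φ κ t u) :
    MemScale φ κ s u := by
  refine Summable.of_nonneg_of_le (fun k => ?_) (fun k => ?_) (Summable.mul_left (B ^ (t - s)) h)
  · exact mul_nonneg (Real.rpow_nonneg (hκ k).le _) (sq_nonneg _)
  · rw [← mul_assoc]
    refine mul_le_mul_of_nonneg_right ?_ (sq_nonneg _)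
    calc κ k ^ (-s) = κ k ^ (t - s) * κ k ^ (-t) := by
          rw [← Real.rpow_add (hκ k)]
          congr 1
          ring
      _ ≤ B ^ (t - s) * κ k ^ (-t) :=
          mul_le_mul_of_nonneg_right (Real.rpow_le_rpow (hκ k).le (hB k) (by linarith))
            (Real.rpow_nonneg (hκ k).le _)

/-- An element of `X^γ` is `C₀^{1/2} z` with `z = C₀^{(γ-1)/2} w` and `w` in `X`. -/
theorem MemScale.exists_eq {φ : HilbertBasis ℕ ℝ X} {κ : ℕ → ℝ} {B : ℝ} (hκ : ∀ k, 0 < κ k)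
    (hB : ∀ k, κ k ≤ B) {D : X →L[ℝ] X} (hD : ∀ k x, ⟪φ k, D x⟫ = √(κ k) * ⟪φ k, x⟫)
    {γ : ℝ} (hγ : 1 ≤ γ) {u : X} (h : MemScale φ κ γ u) :
    ∃ z w : X, D z = u ∧ ∀ k, ⟪φ k, z⟫ = κ k ^ ((γ - 1) / 2) * ⟪φ k, w⟫ := by
  obtain ⟨w, hw⟩ := exists_of_summable_sq φ (a := fun k => κ k ^ (-γ / 2) * ⟪φ k, u⟫) (by
    refine h.congr fun k => ?_
    rw [mul_pow, ← Real.rpow_natCast (κ k ^ (-γ / 2)), ← Real.rpow_mul (hκ k).le]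
    congr 2
    push_cast
    ring)
  obtain ⟨T, hT⟩ := exists_diagonal φ (d := fun k => κ k ^ ((γ - 1) / 2))
    (B := B ^ ((γ - 1) / 2)) fun k => by
      rw [abs_of_nonneg (Real.rpow_nonneg (hκ k).le _)]
      exact Real.rpow_le_rpow (hκ k).le (hB k) (by linarith)
  refine ⟨T w, w, ext_inner_basis φ fun k => ?_, fun k => hT k w⟩
  rw [hD, hT, hw, ← mul_assoc, ← mul_assoc, Real.sqrt_eq_rpow, ← Real.rpow_add (hκ k),
    ← Real.rpow_add (hκ k)]
  have : (1 / 2 + (γ - 1) / 2 + -γ / 2 : ℝ) = 0 := by ring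
  rw [this, Real.rpow_zero, one_mul]

variable [CompleteSpace X] [SecondCountableTopology X] [MeasurableSpace X] [BorelSpace X]

/-- Draws from the prior lie in `X^{1-Δ}` if `C₀^Δ` is trace class. -/
theorem ae_memScale_prior {μ : Measure X} [IsProbabilityMeasure μ] {C₀ D : X →L[ℝ] X}
    {φ : HilbertBasis ℕ ℝ X} {κ : ℕ → ℝ} (hκ : ∀ k, 0 < κ k) (hμ : IsCenteredGaussian μ C₀)
    (hDC : ∀ a b, ⟪C₀ a, b⟫ = ⟪D a, D b⟫) (hD : ∀ k, D (φ k) = √(κ k) • φ k) {Δ : ℝ}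
    (hΔ : Summable fun k => κ k ^ Δ) (τ : ℝ) :
    ∀ᵐ u ∂(prior μ τ), MemScale φ κ (1 - Δ) u := by
  have hm : ∀ k, Measurable fun u : X => ENNReal.ofReal (κ k ^ (-(1 - Δ)) * ⟪φ k, u⟫ ^ 2) :=
    fun k => by fun_prop
  have hk : ∀ k, ∫⁻ u, ENNReal.ofReal (κ k ^ (-(1 - Δ)) * ⟪φ k, u⟫ ^ 2) ∂(prior μ τ) =
      ENNReal.ofReal (τ ^ 2 * κ k ^ Δ) := fun k => by
    have hpos : 0 ≤ κ k ^ (-(1 - Δ)) := Real.rpow_nonneg (hκ k).le _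
    have e := lintegral_add_const_sq_gaussianReal (‖τ • D (φ k)‖₊ ^ 2) 0
    rw [← map_inner_prior hμ hDC, lintegral_map (by fun_prop) (by fun_prop)] at e
    simp only [add_zero] at e
    simp_rw [ENNReal.ofReal_mul hpos]
    rw [lintegral_const_mul _ (by fun_prop), e, ← ENNReal.ofReal_mul hpos]
    congr 1
    rw [hD]
    push_cast
    rw [norm_smul, norm_smul, φ.orthonormal.1 k, Real.norm_eq_abs, Real.norm_eq_abs, mul_pow,
      sq_abs, mul_one, sq_abs, Real.sq_sqrt (hκ k).le]
    have : κ k ^ Δ = κ k ^ (-(1 - Δ)) * κ k := by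
      rw [← Real.rpow_add_one (hκ k).ne']
      congr 1
      ring
    rw [this]
    ring
  -- The expected squared `X^{1-Δ}` norm is `τ² tr C₀^Δ`, which is finite.
  have hfin : ∫⁻ u, ∑' k, ENNReal.ofReal (κ k ^ (-(1 - Δ)) * ⟪φ k, u⟫ ^ 2) ∂(prior μ τ) ≠ ⊤ := by
    rw [lintegral_tsum fun k => (hm k).aemeasurable]
    simp_rw [hk]
    exact (hΔ.mul_left _).tsum_ofReal_ne_top
  filter_upwards [ae_lt_top (Measurable.tsum hm) hfin] with u hu
  have hs := ENNReal.summable_toReal hu.ne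
  refine hs.congr fun k => ?_
  rw [ENNReal.toReal_ofReal]
  exact mul_nonneg (Real.rpow_nonneg (hκ k).le _) (sq_nonneg _)

/-- The posterior mean square error is bounded by a variance term and a squared bias term. -/
theorem exists_lintegral_posterior_norm_sq_le {μ : Measure X} [IsProbabilityMeasure μ]
    {C₀ C₁ D K R M : X →L[ℝ] X} {φ : HilbertBasis ℕ ℝ X} {κ : ℕ → ℝ} {B : ℝ}
    (hκ : ∀ k, 0 < κ k) (hB : ∀ k, κ k ≤ B) (hμ : IsCenteredGaussian μ C₀)
    (hDC : ∀ a b, ⟪C₀ a, b⟫ = ⟪D a, D b⟫) (hD : ∀ k x, ⟪φ k, D x⟫ = √(κ k) * ⟪φ k, x⟫)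
    (hKs : ∀ a b, ⟪K a, b⟫ = ⟪a, K b⟫) (hR : IsNoiseRoot R)
    (hRC : ∀ x y, ⟪C₁ x, y⟫ = ⟪R x, R y⟫) {P : Measure (ℕ → ℝ)} [IsProbabilityMeasure P]
    (hP : IsCenteredGaussianSeq P φ C₁) (hRM : ∀ z, R (M z) = K (D z)) {Δ c : ℝ} (hΔ : 0 < Δ)
    (hc : 0 < c) (hc1 : c ≤ 1) (hM : ∀ z, c * ∑' k, κ k ^ Δ * ⟪φ k, z⟫ ^ 2 ≤ ‖M z‖ ^ 2)
    (hgood : ∀ τ, ∀ᵐ u ∂(prior μ τ), ∃ w, R w = K u) {ϑ : ℝ} (hϑ0 : 0 ≤ ϑ) (hϑ1 : ϑ ≤ 1)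
    (hϑ : Summable fun k => κ k ^ (1 - Δ * ϑ)) {θ : ℝ} (hθ0 : 0 ≤ θ) (hθ1 : θ ≤ 1) {z w : X}
    (hz : ∀ k, ⟪φ k, z⟫ = κ k ^ (Δ * θ / 2) * ⟪φ k, w⟫) {σ L : ℝ} (hσ0 : 0 ≤ σ) (hσ1 : σ ≤ 1)
    (hL : ∀ k, κ k ≤ L * κ k ^ (Δ * σ)) :
    ∃ A A' : ℝ, 0 ≤ A ∧ ∀ n : ℕ, n ≠ 0 → ∀ τ : ℝ, 0 < τ →
      ∫⁻ y, ∫⁻ u, ENNReal.ofReal (‖u - D z‖ ^ 2) ∂(posteriorLaw φ K μ P n τ y)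
          ∂(likelihood φ K P n (D z)) ≤
        ENNReal.ofReal (A * (τ ^ 2 * (n * τ ^ 2) ^ (-ϑ)) + A' * (n * τ ^ 2) ^ (-(σ + θ))) := by
  have hDs := diagonal_symm hD
  have hDφ := diagonal_apply_basis hD
  refine ⟨4 * c⁻¹ * ∑' k, κ k ^ (1 - Δ * ϑ), 2 * (L * (‖w‖ ^ 2 / c ^ 2)), ?_, ?_⟩
  · have : 0 ≤ ∑' k, κ k ^ (1 - Δ * ϑ) := tsum_nonneg fun k => Real.rpow_nonneg (hκ k).le _
    positivity
  intro n hn τ hτ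
  set t : ℝ := n * τ ^ 2 with ht
  have ht0 : 0 < t := by positivity
  choose p hp using fun k => exists_add_smul_adjoint_eq M ht0.le (φ k)
  obtain ⟨x, hx⟩ := exists_add_smul_adjoint_eq M ht0.le z
  -- The resolvent is symmetric, so the coordinatewise biases are the coordinates of one vector `D
  -- x`, up to sign.
  have hpz : ∀ k, ⟪p k, z⟫ = ⟪φ k, x⟫ := fun k => by
    rw [← hx, ← hp k, inner_add_right, inner_add_left, inner_smul_left, inner_smul_right,
      ContinuousLinearMap.adjoint_inner_left, ContinuousLinearMap.adjoint_inner_right,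
      conj_trivial]
  have hcoord : ∀ u : X, ENNReal.ofReal (‖u - D z‖ ^ 2) =
      ∑' k, ENNReal.ofReal ((⟪φ k, u⟫ - ⟪φ k, D z⟫) ^ 2) := fun u => by
    have := hasSum_inner_sq φ (u - D z)
    simp_rw [inner_sub_right] at this
    rw [← this.tsum_eq, ENNReal.ofReal_tsum_of_nonneg (fun k => sq_nonneg _) this.summable]
  have hmeas : ∀ k, Measurable fun u : X =>
      ENNReal.ofReal ((⟪φ k, u⟫ - ⟪φ k, D z⟫) ^ 2) := fun k => by fun_prop
  simp_rw [hcoord]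
  have hin : ∀ y, ∫⁻ u, ∑' k, ENNReal.ofReal ((⟪φ k, u⟫ - ⟪φ k, D z⟫) ^ 2)
      ∂(posteriorLaw φ K μ P n τ y) =
      ∑' k, ∫⁻ u, ENNReal.ofReal ((⟪φ k, u⟫ - ⟪φ k, D z⟫) ^ 2) ∂(posteriorLaw φ K μ P n τ y) :=
    fun y => lintegral_tsum fun k => (hmeas k).aemeasurable
  simp_rw [hin]
  rw [lintegral_tsum fun k => (Measurable.lintegral_kernel (hmeas k)).aemeasurable]
  have hs1 : Summable fun k => κ k * ⟪φ k, x⟫ ^ 2 := by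
    simpa using summable_rpow_mul_inner_sq φ hκ hB zero_le_one x
  have hterm : ∀ k, ∫⁻ y, ∫⁻ u, ENNReal.ofReal ((⟪φ k, u⟫ - ⟪φ k, D z⟫) ^ 2)
      ∂(posteriorLaw φ K μ P n τ y) ∂(likelihood φ K P n (D z)) ≤
      ENNReal.ofReal (4 * c⁻¹ * (τ ^ 2 * t ^ (-ϑ)) * κ k ^ (1 - Δ * ϑ) +
        2 * (κ k * ⟪φ k, x⟫ ^ 2)) := fun k => by
    refine (lintegral_posterior_coord_le hμ hDC hDs hKs hR hRC hP hRM hn (hgood τ) (hDφ k)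
      (hp k) z).trans (ENNReal.ofReal_le_ofReal ?_)
    rw [Real.sq_sqrt (hκ k).le, hpz]
    have := mul_le_mul_of_nonneg_left
      (posterior_variance_le hκ hB hΔ ht0 hc hc1 hM (hp k) hϑ0 hϑ1) (sq_nonneg τ)
    linarith
  have hS : HasSum (fun k => 4 * c⁻¹ * (τ ^ 2 * t ^ (-ϑ)) * κ k ^ (1 - Δ * ϑ) +
      2 * (κ k * ⟪φ k, x⟫ ^ 2)) _ := (hϑ.hasSum.mul_left _).add (hs1.hasSum.mul_left 2)
  refine (ENNReal.tsum_le_tsum hterm).trans ?_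
  rw [← ENNReal.ofReal_tsum_of_nonneg (fun k => ?_) hS.summable, hS.tsum_eq]
  · refine ENNReal.ofReal_le_ofReal ?_
    have := bias_le hκ hB hΔ ht0 hc hc1 hM hx hθ0 hθ1 hz hσ0 hσ1 hL
    linarith
  · have := hκ k
    positivity

/-- A mean square error of order `rₙ²` implies contraction at rate `rₙ`. -/
theorem posteriorContracts_of_lintegral_le {K : X →L[ℝ] X} {φ : HilbertBasis ℕ ℝ X}
    {μ : Measure X} [IsProbabilityMeasure μ] {P : Measure (ℕ → ℝ)} [IsProbabilityMeasure P]
    {u' : X} {τ r : ℕ → ℝ} {A : ℝ} (hr : ∀ n, n ≠ 0 → 0 < r n)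
    (h : ∀ n : ℕ, n ≠ 0 →
      ∫⁻ y, ∫⁻ u, ENNReal.ofReal (‖u - u'‖ ^ 2) ∂(posteriorLaw φ K μ P n (τ n) y)
        ∂(likelihood φ K P n u') ≤ ENNReal.ofReal (A * r n ^ 2)) :
    PosteriorContracts φ K μ P u' τ r := by
  intro M hM
  have hlim : Tendsto (fun n => ENNReal.ofReal (A / M n ^ 2)) atTop (𝓝 0) := by
    have h1 : Tendsto (fun n => A / M n ^ 2) atTop (𝓝 0) :=
      tendsto_const_nhds.div_atTop ((tendsto_pow_atTop two_ne_zero).comp hM)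
    simpa using ENNReal.tendsto_ofReal h1
  refine tendsto_of_tendsto_of_tendsto_of_le_of_le' tendsto_const_nhds hlim
    (Eventually.of_forall fun n => zero_le) ?_
  filter_upwards [hM.eventually_gt_atTop 0, eventually_ne_atTop 0] with n hMn hn
  have hrn := hr n hn
  have ha : 0 < (M n * r n) ^ 2 := by positivity
  have hbound : ∀ y, posteriorLaw φ K μ P n (τ n) y {u : X | M n * r n ≤ ‖u - u'‖} ≤
      (ENNReal.ofReal ((M n * r n) ^ 2))⁻¹ *
        ∫⁻ u, ENNReal.ofReal (‖u - u'‖ ^ 2) ∂(posteriorLaw φ K μ P n (τ n) y) := fun y => by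
    have hmk := meas_ge_le_lintegral_div (μ := posteriorLaw φ K μ P n (τ n) y)
      (f := fun u : X => ENNReal.ofReal (‖u - u'‖ ^ 2)) (by fun_prop)
      (ε := ENNReal.ofReal ((M n * r n) ^ 2)) (ENNReal.ofReal_pos.2 ha).ne' ENNReal.ofReal_ne_top
    rw [← ENNReal.div_eq_inv_mul]
    refine (measure_mono fun u hu => ?_).trans hmk
    exact ENNReal.ofReal_le_ofReal (pow_le_pow_left₀ (by positivity) hu 2)
  calc ∫⁻ y, posteriorLaw φ K μ P n (τ n) y {u : X | M n * r n ≤ ‖u - u'‖}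
        ∂(likelihood φ K P n u')
      ≤ ∫⁻ y, (ENNReal.ofReal ((M n * r n) ^ 2))⁻¹ *
          ∫⁻ u, ENNReal.ofReal (‖u - u'‖ ^ 2) ∂(posteriorLaw φ K μ P n (τ n) y)
          ∂(likelihood φ K P n u') := lintegral_mono hbound
    _ = (ENNReal.ofReal ((M n * r n) ^ 2))⁻¹ *
          ∫⁻ y, ∫⁻ u, ENNReal.ofReal (‖u - u'‖ ^ 2) ∂(posteriorLaw φ K μ P n (τ n) y)
          ∂(likelihood φ K P n u') :=
        lintegral_const_mul' _ _ (ENNReal.inv_ne_top.2 (ENNReal.ofReal_pos.2 ha).ne')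
    _ ≤ (ENNReal.ofReal ((M n * r n) ^ 2))⁻¹ * ENNReal.ofReal (A * r n ^ 2) := by
        gcongr
        exact h n hn
    _ = ENNReal.ofReal (A / M n ^ 2) := by
        rw [← ENNReal.ofReal_inv_of_pos ha, ← ENNReal.ofReal_mul (by positivity)]
        congr 1
        field_simp

/-- Contraction for a smoothness `γ` below the saturation level `Δ + 1`. -/
theorem posteriorContracts_of_le {C₀ C₁ R K : X →L[ℝ] X} {A : X →ₗ.[ℝ] X}
    {φ : HilbertBasis ℕ ℝ X} {κ : ℕ → ℝ} (hC₀ : IsPosDef C₀) (hφ : ∀ k, C₀ (φ k) = κ k • φ k)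
    (hC₁ : IsPosDef C₁) (hR : IsPosSqrt R C₁) (hA : IsPosDefWithInverse A K)
    {s₀ β ℓ : ℝ} (hS : ScaleAssumptions φ κ C₁ R K s₀ β ℓ)
    {μ : Measure X} [IsProbabilityMeasure μ] (hμ : IsCenteredGaussian μ C₀)
    {P : Measure (ℕ → ℝ)} [IsProbabilityMeasure P] (hP : IsCenteredGaussianSeq P φ C₁)
    {Δ : ℝ} (hΔ : Δ = 2 * ℓ - β + 1) {γ : ℝ} (hγ : 1 ≤ γ) (hγΔ : γ ≤ Δ + 1) {u' : X}
    (hu' : MemScale φ κ γ u') {ε : ℝ} (hε : 0 < ε) :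
    PosteriorContracts φ K μ P u'
      (fun n => (n : ℝ) ^ (-((γ - 1 + s₀ + ε) / (2 * (Δ + γ - 1 + s₀ + ε)))))
      (fun n => if β - 2 * ℓ ≤ 0
        then (n : ℝ) ^ (-(γ / (2 * (Δ + γ - 1 + s₀ + ε))))
        else (n : ℝ) ^ (-((Δ + γ - 1) / (2 * (Δ + γ - 1 + s₀ + ε))))) := by
  have hs0 := hS.s₀_nonneg
  have hs1 := hS.s₀_lt_one
  have hΔs : 2 * s₀ < Δ := hΔ ▸ hS.illPosed
  have hΔ0 : 0 < Δ := by linarith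
  have hC₀s : ∀ x y, ⟪C₀ x, y⟫ = ⟪x, C₀ y⟫ := fun x y => by
    rw [← ContinuousLinearMap.adjoint_inner_right, hC₀.isSelfAdjoint.adjoint_eq]
  have hκ := hC₀.eigenvalue_pos hφ
  have hB := eigenvalue_le_opNorm hφ
  set B := ‖C₀‖
  obtain ⟨D, hD⟩ := exists_diagonal φ (d := fun k => √(κ k)) (B := √B) fun k => by
    rw [abs_of_nonneg (Real.sqrt_nonneg _)]
    exact Real.sqrt_le_sqrt (hB k)
  have hDC : ∀ a b, ⟪C₀ a, b⟫ = ⟪D a, D b⟫ := fun a b => by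
    refine (hasSum_inner_mul φ (C₀ a) b).unique ?_
    convert hasSum_inner_mul φ (D a) (D b) using 2 with k
    rw [hD, hD, inner_eigen hC₀s hφ]
    nth_rewrite 1 [← Real.mul_self_sqrt (hκ k).le]
    ring
  have hDφ := diagonal_apply_basis hD
  have hRn := hR.isNoiseRoot hC₁
  have hβΔ : β - 2 * ℓ = 1 - Δ := by linarith
  have hfwd := hS.equiv_forward
  rw [hβΔ] at hfwd
  obtain ⟨M, hRM, c, hc, hc1, hM⟩ := exists_whitened_forward hκ hB hRn hD hΔ0 hfwd
  have hgood : ∀ τ, ∀ᵐ u ∂(prior μ τ), ∃ w, R w = K u := fun τ => by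
    filter_upwards [ae_memScale_prior hκ hμ hDC hDφ
      (hS.traceClass Δ (by linarith)) τ] with u hu
    obtain ⟨_, _, _, _, hf⟩ := hfwd
    obtain ⟨w, hw, -⟩ := hf u hu
    exact ⟨w, hw⟩
  obtain ⟨z, w, rfl, hz⟩ := hu'.exists_eq hκ hB hD hγ
  have hE0 : 0 < s₀ + ε := by linarith
  set d : ℝ := Δ + γ - 1 + s₀ + ε with hd
  have hd0 : 0 < d := by linarith
  -- the exponents of the variance, the smoothness and the norm in terms of `C₀^Δ`
  obtain ⟨ϑ, hϑ0, hϑ1, hϑs, hϑv⟩ : ∃ ϑ : ℝ, 0 ≤ ϑ ∧ ϑ ≤ 1 ∧ s₀ < 1 - Δ * ϑ ∧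
      (if 1 - Δ ≤ 0 then γ else Δ + γ - 1) ≤ γ - 1 + s₀ + ε + Δ * ϑ := by
    rcases le_total 1 (s₀ + ε) with h1 | h1
    · refine ⟨0, le_rfl, zero_le_one, by linarith, ?_⟩
      split_ifs <;> linarith
    rcases le_total (1 - (s₀ + ε)) Δ with h2 | h2
    · have e : Δ * ((1 - (s₀ + ε)) / Δ) = 1 - (s₀ + ε) := by field_simp
      refine ⟨(1 - (s₀ + ε)) / Δ, div_nonneg (by linarith) hΔ0.le, (div_le_one hΔ0).2 h2, ?_, ?_⟩
      · rw [e]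
        linarith
      · rw [e]
        split_ifs <;> linarith
    · refine ⟨1, zero_le_one, le_rfl, by linarith, ?_⟩
      split_ifs <;> linarith
  -- Interpolation reaches weights `κ^{Δσ}` with `σ ≤ 1` only. For `Δ < 1` the weight `κ` is out of
  -- reach and is bounded by a multiple of `κ^Δ`, hence the second form of the rate.
  obtain ⟨σ, L, hσ0, hσ1, hL, hσv⟩ : ∃ σ L : ℝ, 0 ≤ σ ∧ σ ≤ 1 ∧ (∀ k, κ k ≤ L * κ k ^ (Δ * σ)) ∧
      (if 1 - Δ ≤ 0 then γ else Δ + γ - 1) = Δ * (σ + (γ - 1) / Δ) := by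
    by_cases h : 1 - Δ ≤ 0
    · refine ⟨1 / Δ, 1, by positivity, (div_le_one hΔ0).2 (by linarith), fun k => ?_, ?_⟩
      · rw [mul_one_div_cancel hΔ0.ne', Real.rpow_one, one_mul]
      · rw [if_pos h]
        field_simp
        ring
    · push Not at h
      refine ⟨1, B ^ (1 - Δ), zero_le_one, le_rfl, fun k => ?_, ?_⟩
      · calc κ k = κ k ^ (1 - Δ) * κ k ^ (Δ * 1) := by
              rw [← Real.rpow_add (hκ k)]
              simp
          _ ≤ B ^ (1 - Δ) * κ k ^ (Δ * 1) :=
              mul_le_mul_of_nonneg_right (Real.rpow_le_rpow (hκ k).le (hB k) h.le)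
                (Real.rpow_nonneg (hκ k).le _)
      · rw [if_neg (not_le.2 h)]
        field_simp
        ring
  set T : ℝ := if 1 - Δ ≤ 0 then γ else Δ + γ - 1 with hT
  have hz' : ∀ k, ⟪φ k, z⟫ = κ k ^ (Δ * ((γ - 1) / Δ) / 2) * ⟪φ k, w⟫ := fun k => by
    rw [hz, mul_div_cancel₀ _ hΔ0.ne']
  obtain ⟨A₁, A₂, hA₁, hmse⟩ := exists_lintegral_posterior_norm_sq_le hκ hB hμ hDC hD hA.symm hRn
    hR.inner_eq hP hRM hΔ0 hc hc1 hM hgood hϑ0 hϑ1 (hS.traceClass _ hϑs)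
    (θ := (γ - 1) / Δ) (div_nonneg (by linarith) hΔ0.le)
    ((div_le_one hΔ0).2 (by linarith)) hz' hσ0 hσ1 hL
  have hrate : ∀ n : ℕ, (if β - 2 * ℓ ≤ 0 then (n : ℝ) ^ (-(γ / (2 * d)))
      else (n : ℝ) ^ (-((Δ + γ - 1) / (2 * d)))) = (n : ℝ) ^ (-(T / (2 * d))) := fun n => by
    rw [hβΔ, hT]
    split_ifs <;> rfl
  simp_rw [hrate]
  refine posteriorContracts_of_lintegral_le (A := A₁ + A₂)
    (fun n hn => Real.rpow_pos_of_pos (by positivity) _) fun n hn => ?_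
  have hn0 : (0 : ℝ) < n := by positivity
  have hn1 : (1 : ℝ) ≤ n := by exact_mod_cast Nat.one_le_iff_ne_zero.2 hn
  refine (hmse n hn _ (Real.rpow_pos_of_pos hn0 _)).trans (ENNReal.ofReal_le_ofReal ?_)
  have hτ : ((n : ℝ) ^ (-((γ - 1 + s₀ + ε) / (2 * d)))) ^ 2 =
      (n : ℝ) ^ (-((γ - 1 + s₀ + ε) / d)) := by
    rw [← Real.rpow_natCast, ← Real.rpow_mul hn0.le]
    congr 1
    field_simp
    push_cast
    ring
  have hr : ((n : ℝ) ^ (-(T / (2 * d)))) ^ 2 = (n : ℝ) ^ (-(T / d)) := by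
    rw [← Real.rpow_natCast, ← Real.rpow_mul hn0.le]
    congr 1
    field_simp
    push_cast
    ring
  -- With this scaling `t = n τ² = n^{Δ/d}`, so the bias term is exactly `n^{-T/d}`, up to its
  -- constant.
  have ht : (n : ℝ) * (n : ℝ) ^ (-((γ - 1 + s₀ + ε) / d)) = (n : ℝ) ^ (Δ / d) := by
    rw [← Real.rpow_one_add' hn0.le]
    · congr 1
      field_simp
      rw [hd]
      ring
    · have : 1 + -((γ - 1 + s₀ + ε) / d) = Δ / d := by
        field_simp
        rw [hd]
        ring
      rw [this]
      positivity
  rw [hτ, hr, ht, ← Real.rpow_mul hn0.le, ← Real.rpow_mul hn0.le, ← Real.rpow_add hn0]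
  have e1 : Δ / d * -(σ + (γ - 1) / Δ) = -(T / d) := by
    rw [hσv]
    field_simp
  have e2 : -((γ - 1 + s₀ + ε) / d) + Δ / d * -ϑ ≤ -(T / d) := by
    have : -((γ - 1 + s₀ + ε) / d) + Δ / d * -ϑ = -((γ - 1 + s₀ + ε + Δ * ϑ) / d) := by ring
    rw [this]
    exact neg_le_neg (div_le_div_of_nonneg_right hϑv hd0.le)
  rw [e1, add_mul]
  have := mul_le_mul_of_nonneg_left (Real.rpow_le_rpow_of_exponent_le hn1 e2) hA₁
  linarith

end Contraction

end LinInv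

theorem theorem2p3 {X : Type*} [NormedAddCommGroup X] [InnerProductSpace ℝ X] [CompleteSpace X]
    [SecondCountableTopology X] [MeasurableSpace X] [BorelSpace X]
    (C₀ C₁ R K : X →L[ℝ] X) (A : X →ₗ.[ℝ] X) (φ : HilbertBasis ℕ ℝ X) (κ : ℕ → ℝ)
    (hC₀ : LinInv.IsPosDef C₀) (hφ : ∀ k, C₀ (φ k) = κ k • φ k)
    (hC₁ : LinInv.IsPosDef C₁) (hR : LinInv.IsPosSqrt R C₁)
    (hA : LinInv.IsPosDefWithInverse A K)
    (s₀ β ℓ : ℝ) (hS : LinInv.ScaleAssumptions φ κ C₁ R K s₀ β ℓ)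
    (μ : Measure X) [IsProbabilityMeasure μ] (hμ : LinInv.IsCenteredGaussian μ C₀)
    (P : Measure (ℕ → ℝ)) [IsProbabilityMeasure P] (hP : LinInv.IsCenteredGaussianSeq P φ C₁)
    (Δ : ℝ) (hΔ : Δ = 2 * ℓ - β + 1)
    (γ : ℝ) (hγ : 1 ≤ γ) (u' : X) (hu' : LinInv.MemScale φ κ γ u')
    (ε : ℝ) (hε : 0 < ε) :
    (γ ≤ Δ + 1 →
      LinInv.PosteriorContracts φ K μ P u'
        (fun n => (n : ℝ) ^ (-((γ - 1 + s₀ + ε) / (2 * (Δ + γ - 1 + s₀ + ε)))))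
        (fun n => if β - 2 * ℓ ≤ 0
          then (n : ℝ) ^ (-(γ / (2 * (Δ + γ - 1 + s₀ + ε))))
          else (n : ℝ) ^ (-((Δ + γ - 1) / (2 * (Δ + γ - 1 + s₀ + ε)))))) ∧
    (Δ + 1 < γ →
      LinInv.PosteriorContracts φ K μ P u'
        (fun n => (n : ℝ) ^ (-((Δ + s₀ + ε) / (2 * (2 * Δ + s₀ + ε)))))
        (fun n => if β - 2 * ℓ ≤ 0
          then (n : ℝ) ^ (-((Δ + 1) / (2 * (2 * Δ + s₀ + ε))))
          else (n : ℝ) ^ (-(Δ / (2 * Δ + s₀ + ε))))) := by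
  refine ⟨fun h => LinInv.posteriorContracts_of_le hC₀ hφ hC₁ hR hA hS hμ hP hΔ hγ h hu' hε,
    fun h => ?_⟩
  have hΔ0 : 0 < Δ := by linarith [hS.illPosed, hS.s₀_nonneg]
  -- Saturation: `X^γ ⊆ X^{Δ+1}`, and the exponents at smoothness `Δ + 1` are those claimed.
  have key := LinInv.posteriorContracts_of_le hC₀ hφ hC₁ hR hA hS hμ hP hΔ
    (γ := Δ + 1) (by linarith) le_rfl (hu'.mono (hC₀.eigenvalue_pos hφ)
      (LinInv.eigenvalue_le_opNorm hφ) h.le) hε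
  have e1 : Δ + 1 - 1 + s₀ + ε = Δ + s₀ + ε := by ring
  have e2 : Δ + (Δ + 1) - 1 + s₀ + ε = 2 * Δ + s₀ + ε := by ring
  have e3 : (Δ + (Δ + 1) - 1) / (2 * (2 * Δ + s₀ + ε)) = Δ / (2 * Δ + s₀ + ε) := by
    rw [show Δ + (Δ + 1) - 1 = 2 * Δ by ring, mul_div_mul_left _ _ two_ne_zero]
  simpa only [e1, e2, e3] using key
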